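/- There are a single deterministic word-RAM program $P$ and, for every $\Delta\in\mathbb N$, a constant $c=c(\Delta)$ such that the following holds. Let $G=(V,E)$ be a connected finite simple undirected graph with $V=\{0,\dots,n-1\}$ and $m=|E|$ edges that is chordal (every cycle of length at least $4$ has a chord) and in which every vertex has degree at most $\Delta$. If $P$ is started on any adjacency-list representation of $G$ (the neighbours of each vertex being listed in any order), then $P$ halts after at most $c\,(m+1)$ steps, uses only memory words holding integers in $\{0,\dots,c\,(n+1)\}$ (words of $O(\log n)$ bits for fixed $\Delta$), and outputs the eccentricity $e(v)=\max_{u\in V}d(v,u)$ of every vertex $v\in V$, where $d$ is the shortest-path distance in $G$. In particular, for chordal graphs with vertex degrees bounded by a constant, all eccentricities are computed in total $O(m)$ time. Here one step is one elementary instruction (setting a register to a literal constant, copying, addition or truncated subtraction of registers, reading or writing one array cell at an index held in a register, a no-operation) or one evaluation of a branch or loop test comparing two registers. -/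

import Mathlib

/-- A graph is chordal if every cycle of length at least four has a chord: an edge of the graph
which joins two vertices of the cycle and is not an edge of the cycle. -/
def SimpleGraph.IsChordal {V : Type*} (G : SimpleGraph V) : Prop :=
  ∀ (v : V) (p : G.Walk v v), p.IsCycle → 4 ≤ p.length →
    ∃ x ∈ p.support, ∃ y ∈ p.support, G.Adj x y ∧ s(x, y) ∉ p.edges

namespace WordRAM

/-- Programs of a word RAM with registers and arrays, both indexed by natural numbers. The names of
registers and arrays, and the constants, are literals, so a program uses only finitely many
of each; arrays are addressed indirectly through registers. -/
inductive Cmd : Type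
  /-- do nothing -/
  | skip : Cmd
  /-- register `r` becomes the literal `k` -/
  | const (r k : ℕ) : Cmd
  /-- register `r` becomes the content of register `x` -/
  | copy (r x : ℕ) : Cmd
  /-- register `r` becomes the sum of registers `x` and `y` -/
  | add (r x y : ℕ) : Cmd
  /-- register `r` becomes the truncated difference of registers `x` and `y` -/
  | sub (r x y : ℕ) : Cmd
  /-- register `r` becomes the cell of array `A` whose index is in register `x` -/
  | load (r A x : ℕ) : Cmd
  /-- the cell of array `A` whose index is in register `x` becomes the content of register `y` -/
  | store (A x y : ℕ) : Cmd
  /-- sequential composition -/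
  | seq (P Q : Cmd) : Cmd
  /-- run `P` if register `x` is less than register `y`, and `Q` otherwise -/
  | branch (x y : ℕ) (P Q : Cmd) : Cmd
  /-- run `P` as long as register `x` is less than register `y` -/
  | loop (x y : ℕ) (P : Cmd) : Cmd

/-- A memory state: the contents of the registers and of the arrays. -/
@[ext]
structure State : Type where
  /-- `reg r` is the content of register `r` -/
  reg : ℕ → ℕ
  /-- `arr A i` is the content of cell `i` of array `A` -/
  arr : ℕ → ℕ → ℕ

/-- Write `k` to register `r`. -/
def State.setReg (s : State) (r k : ℕ) : State where
  reg := Function.update s.reg r k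
  arr := s.arr

/-- Write `k` to cell `i` of array `A`. -/
def State.setArr (s : State) (A i k : ℕ) : State where
  reg := s.reg
  arr := Function.update s.arr A (Function.update (s.arr A) i k)

/-- `Exec W P s t s'`: on a machine whose words hold the numbers `0, …, W`, the program `P`
started in state `s` halts after exactly `t` steps in state `s'`. Every elementary instruction
and every evaluation of a test of a branch or of a loop is one step. An instruction whose result
is larger than `W` blocks: no computation goes through it. -/
inductive Exec (W : ℕ) : Cmd → State → ℕ → State → Prop
  | skip (s : State) : Exec W .skip s 1 s
  | const (s : State) (r k : ℕ) (h : k ≤ W) : Exec W (.const r k) s 1 (s.setReg r k)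
  | copy (s : State) (r x : ℕ) (h : s.reg x ≤ W) :
      Exec W (.copy r x) s 1 (s.setReg r (s.reg x))
  | add (s : State) (r x y : ℕ) (h : s.reg x + s.reg y ≤ W) :
      Exec W (.add r x y) s 1 (s.setReg r (s.reg x + s.reg y))
  | sub (s : State) (r x y : ℕ) (h : s.reg x - s.reg y ≤ W) :
      Exec W (.sub r x y) s 1 (s.setReg r (s.reg x - s.reg y))
  | load (s : State) (r A x : ℕ) (h : s.arr A (s.reg x) ≤ W) :
      Exec W (.load r A x) s 1 (s.setReg r (s.arr A (s.reg x)))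
  | store (s : State) (A x y : ℕ) (h : s.reg y ≤ W) :
      Exec W (.store A x y) s 1 (s.setArr A (s.reg x) (s.reg y))
  | seq {P Q : Cmd} {s s' s'' : State} {t t' : ℕ} (hP : Exec W P s t s') (hQ : Exec W Q s' t' s'') :
      Exec W (.seq P Q) s (t + t') s''
  | branch_true {x y : ℕ} {P Q : Cmd} {s s' : State} {t : ℕ} (h : s.reg x < s.reg y)
      (hP : Exec W P s t s') : Exec W (.branch x y P Q) s (t + 1) s'
  | branch_false {x y : ℕ} {P Q : Cmd} {s s' : State} {t : ℕ} (h : ¬ s.reg x < s.reg y)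
      (hQ : Exec W Q s t s') : Exec W (.branch x y P Q) s (t + 1) s'
  | loop_true {x y : ℕ} {P : Cmd} {s s' s'' : State} {t t' : ℕ} (h : s.reg x < s.reg y)
      (hP : Exec W P s t s') (hL : Exec W (.loop x y P) s' t' s'') :
      Exec W (.loop x y P) s (t + t' + 1) s''
  | loop_false {x y : ℕ} {P : Cmd} {s : State} (h : ¬ s.reg x < s.reg y) :
      Exec W (.loop x y P) s 1 s

/-- Adjacency lists of a graph on `{0, …, n - 1}`: for every vertex, a list of its neighbours,
each neighbour once, in any order. -/
structure AdjLists {n : ℕ} (G : SimpleGraph (Fin n)) : Type where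
  /-- the list of the neighbours of a vertex -/
  nbrs : Fin n → List (Fin n)
  nodup : ∀ v, (nbrs v).Nodup
  mem_nbrs : ∀ v w, w ∈ nbrs v ↔ G.Adj v w

/-- The initial state for a graph given by adjacency lists. Register `0` holds the number `n` of
vertices. Array `1` holds the concatenation of the adjacency lists of the vertices
`0, 1, …, n - 1`, and, for `k ≤ n`, cell `k` of array `0` holds the total length of the
lists of the vertices smaller than `k`. Thus the neighbours of `v` are in the cells `i` of array `1`
for which `i` is at least cell `v` and less than cell `v + 1` of array `0`. The rest is zero. -/
def AdjLists.inputState {n : ℕ} {G : SimpleGraph (Fin n)} (L : AdjLists G) : State where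
  reg := fun r => if r = 0 then n else 0
  arr := fun A i =>
    if A = 0 then
      if i ≤ n then ∑ v : Fin n with v.val < i, (L.nbrs v).length else 0
    else if A = 1 then
      (((List.finRange n).flatMap L.nbrs).map Fin.val).getD i 0
    else 0

end WordRAM

namespace SimpleGraph

variable {V : Type*} {G : SimpleGraph V}

/-- A walk inside a vertex set can be replaced by a chordless path inside that set. -/
theorem Walk.exists_chordless_path {S : Set V} {x y : V} (w : G.Walk x y)
    (hw : ∀ z ∈ w.support, z ∈ S) :
    ∃ p : G.Walk x y, p.IsPath ∧ (∀ z ∈ p.support, z ∈ S) ∧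
      ∀ s ∈ p.support, ∀ t ∈ p.support, G.Adj s t → s(s, t) ∈ p.edges := by
  classical
  have hex : ∃ k, ∃ p : G.Walk x y, p.length = k ∧ ∀ z ∈ p.support, z ∈ S := ⟨_, w, rfl, hw⟩
  obtain ⟨p, hpl, hpS⟩ := Nat.find_spec hex
  have hmin : ∀ q : G.Walk x y, (∀ z ∈ q.support, z ∈ S) → p.length ≤ q.length := fun q hq =>
    hpl ▸ Nat.find_min' hex ⟨q, rfl, hq⟩
  have key : ∀ i j, i < j → j ≤ p.bypass.length →
      G.Adj (p.bypass.getVert i) (p.bypass.getVert j) →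
      s(p.bypass.getVert i, p.bypass.getVert j) ∈ p.bypass.edges := by
    intro i j hij hj hadj
    rcases Nat.lt_or_ge (i + 1) j with h | h
    · exfalso
      have h1 := hmin ((p.bypass.take i).append (Walk.cons hadj (p.bypass.drop j))) (by
        intro z hz
        apply hpS
        apply p.support_bypass_subset_support
        rw [Walk.mem_support_append_iff, Walk.support_cons, List.mem_cons] at hz
        rcases hz with hz | hz | hz
        · exact (Walk.isSubwalk_take p.bypass i).support_subset hz
        · exact hz ▸ Walk.getVert_mem_support _ _
        · exact (Walk.isSubwalk_drop p.bypass j).support_subset hz)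
      have h2 := p.length_bypass_le_length
      simp only [Walk.length_append, Walk.length_cons, Walk.take_length, Walk.drop_length] at h1
      omega
    · obtain rfl : j = i + 1 := by omega
      exact (Walk.mk_mem_edges_iff_exists _).2 ⟨i, by omega, rfl⟩
  refine ⟨p.bypass, p.bypass_isPath, fun z hz => hpS z (p.support_bypass_subset_support hz), ?_⟩
  intro s hs t ht hst
  obtain ⟨i, rfl, hi⟩ := Walk.mem_support_iff_exists_getVert.1 hs
  obtain ⟨j, rfl, hj⟩ := Walk.mem_support_iff_exists_getVert.1 ht
  rcases lt_trichotomy i j with h | h | h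
  · exact key i j h hj hst
  · exact absurd (h ▸ hst) (G.irrefl)
  · rw [Sym2.eq_swap]
    exact key j i h hi hst.symm

/-- Two paths with the same ends and no other common vertex form a cycle. -/
theorem Walk.IsPath.isCycle_append_reverse {x y : V} {p q : G.Walk x y} (hp : p.IsPath)
    (hq : q.IsPath) (hxy : ¬ G.Adj x y) (hne : x ≠ y)
    (hd : ∀ z, z ∈ p.support → z ∈ q.support → z = x ∨ z = y) :
    (p.append q.reverse).IsCycle := by
  cases p with
  | nil => exact absurd rfl hne
  | @cons _ a _ h p' =>
    rw [Walk.cons_isPath_iff] at hp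
    have hay : a ≠ y := fun e => hxy (e ▸ h)
    rw [Walk.cons_append, Walk.cons_isCycle_iff]
    constructor
    · rw [Walk.isPath_def, Walk.support_append, List.nodup_append]
      refine ⟨hp.1.support_nodup, hq.reverse.support_nodup.tail, ?_⟩
      intro b hb c hc hbc
      subst hbc
      have hbq : b ∈ q.support := by
        have := List.mem_of_mem_tail hc
        simpa using this
      rcases hd b (by simp [hb]) hbq with e | e
      · exact hp.2 (e ▸ hb)
      · subst e
        have := hq.reverse.support_nodup
        rw [← Walk.cons_tail_support] at this
        exact (List.nodup_cons.1 this).1 hc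
    · rw [Walk.edges_append, List.mem_append]
      rintro (e | e)
      · exact hp.2 (Walk.fst_mem_support_of_mem_edges _ e)
      · have haq : a ∈ q.support := by
          simpa using Walk.snd_mem_support_of_mem_edges _ e
        rcases hd a (by simp) haq with e | e
        · exact h.ne e.symm
        · exact hay e

/-- In a chordal graph, two vertices that are joined by two walks whose inner vertices are in sets
without edges between them are equal or adjacent. -/
theorem IsChordal.eq_or_adj_of_walks (hG : G.IsChordal) {A B : Set V} (hAB : Disjoint A B)
    (hnadj : ∀ a ∈ A, ∀ b ∈ B, ¬ G.Adj a b) {x y : V}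
    (p : G.Walk x y) (hp : ∀ z ∈ p.support, z = x ∨ z = y ∨ z ∈ A)
    (q : G.Walk x y) (hq : ∀ z ∈ q.support, z = x ∨ z = y ∨ z ∈ B)
    (hxA : x ∉ A) (hyA : y ∉ A) : x = y ∨ G.Adj x y := by
  by_contra! hcon
  obtain ⟨hne, hxy⟩ := hcon
  obtain ⟨p, hpp, hpA, hpc⟩ := p.exists_chordless_path (S := {z | z = x ∨ z = y ∨ z ∈ A}) hp
  obtain ⟨q, hqp, hqB, hqc⟩ := q.exists_chordless_path (S := {z | z = x ∨ z = y ∨ z ∈ B}) hq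
  have hd : ∀ z, z ∈ p.support → z ∈ q.support → z = x ∨ z = y := by
    intro z h1 h2
    rcases hpA z h1 with h | h | h
    · exact Or.inl h
    · exact Or.inr h
    · rcases hqB z h2 with h' | h' | h'
      · exact Or.inl h'
      · exact Or.inr h'
      · exact absurd h' (Set.disjoint_left.1 hAB h)
  have two : ∀ r : G.Walk x y, 2 ≤ r.length := by
    intro r
    by_contra! hr
    interval_cases hl : r.length
    · exact hne (Walk.eq_of_length_eq_zero hl)
    · exact hxy (Walk.adj_of_length_eq_one hl)
  have hcyc := hpp.isCycle_append_reverse hqp hxy hne hd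
  obtain ⟨s, hs, t, ht, hst, hnot⟩ := hG x _ hcyc (by
    have := two p; have := two q
    simp only [Walk.length_append, Walk.length_reverse]; omega)
  rw [Walk.edges_append, Walk.edges_reverse, List.mem_append, List.mem_reverse, not_or] at hnot
  have ends : ∀ z, z = x ∨ z = y → z ∈ p.support ∧ z ∈ q.support := by
    rintro z (rfl | rfl) <;> simp
  have hs' : s ∈ p.support ∨ s ∈ q.support := by simpa [Walk.mem_support_append_iff] using hs
  have ht' : t ∈ p.support ∨ t ∈ q.support := by simpa [Walk.mem_support_append_iff] using ht
  have cross : ∀ s t, s ∈ p.support → t ∈ q.support → G.Adj s t →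
      s(s, t) ∈ p.edges ∨ s(s, t) ∈ q.edges := by
    intro s t hs ht hst
    rcases hpA s hs with h | h | h
    · exact Or.inr (hqc s (ends s (Or.inl h)).2 t ht hst)
    · exact Or.inr (hqc s (ends s (Or.inr h)).2 t ht hst)
    rcases hqB t ht with h' | h' | h'
    · exact Or.inl (hpc s hs t (ends t (Or.inl h')).1 hst)
    · exact Or.inl (hpc s hs t (ends t (Or.inr h')).1 hst)
    · exact absurd hst (hnadj s h t h')
  rcases hs' with hs' | hs' <;> rcases ht' with ht' | ht'
  · exact hnot.1 (hpc s hs' t ht' hst)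
  · exact (cross s t hs' ht' hst).elim hnot.1 hnot.2
  · have := cross t s ht' hs' hst.symm
    rw [Sym2.eq_swap] at this
    exact this.elim hnot.1 hnot.2
  · exact hnot.2 (hqc s hs' t ht' hst)

theorem Connected.exists_geodesic_split (hc : G.Connected) (c u : V) {k : ℕ}
    (hk : k ≤ G.dist c u) :
    ∃ (x : V) (p : G.Walk c x) (q : G.Walk x u), G.dist c x = k ∧ G.dist x u + k = G.dist c u ∧
      (∀ z ∈ p.support, z = x ∨ G.dist c z < k) ∧ ∀ z ∈ q.support, z = x ∨ k < G.dist c z := by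
  obtain ⟨p, hp⟩ := hc.exists_walk_length_eq_dist c u
  have key : ∀ i ≤ p.length, G.dist c (p.getVert i) = i ∧ G.dist (p.getVert i) u + i = p.length := by
    intro i hi
    have h1 := dist_le (p.take i)
    have h2 := dist_le (p.drop i)
    have h3 := hc.dist_triangle (u := c) (v := p.getVert i) (w := u)
    rw [Walk.take_length] at h1
    rw [Walk.drop_length] at h2
    omega
  refine ⟨p.getVert k, p.take k, p.drop k, (key k (by omega)).1, by
    have := (key k (by omega)).2; omega, ?_, ?_⟩
  · intro z hz
    obtain ⟨i, rfl, hi⟩ := Walk.mem_support_iff_exists_getVert.1 hz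
    rw [Walk.take_length] at hi
    rw [Walk.take_getVert]
    rcases eq_or_ne i k with rfl | hik
    · left; simp
    · right
      rw [(key _ (by omega)).1]; omega
  · intro z hz
    obtain ⟨i, rfl, hi⟩ := Walk.mem_support_iff_exists_getVert.1 hz
    rw [Walk.drop_length] at hi
    rw [Walk.drop_getVert]
    rcases eq_or_ne i 0 with rfl | hik
    · left; simp
    · right
      rw [(key _ (by omega)).1]; omega

/-- If a walk between two vertices avoids a ball in a chordal graph, then the detour between them
over some vertex of the ball is short. -/
theorem IsChordal.exists_short_detour (hG : G.IsChordal) (hc : G.Connected) {c u v : V} {r : ℕ}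
    (w : G.Walk u v) (hw : ∀ z ∈ w.support, r < G.dist c z) :
    ∃ b, G.dist c b ≤ r ∧ G.dist u b + G.dist b v + 2 * r ≤ G.dist c u + G.dist c v + 1 := by
  obtain ⟨x, px, qx, hx, hxu, hpx, hqx⟩ :=
    hc.exists_geodesic_split c u (hw u w.start_mem_support).le
  obtain ⟨y, py, qy, hy, hyv, hpy, hqy⟩ :=
    hc.exists_geodesic_split c v (hw v w.end_mem_support).le
  have hxy : x = y ∨ G.Adj x y := by
    rcases Nat.eq_zero_or_pos r with rfl | hr
    · left
      rw [hc.dist_eq_zero_iff] at hx hy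
      exact hx.symm.trans hy
    refine hG.eq_or_adj_of_walks (A := {z | r < G.dist c z}) (B := {z | G.dist c z < r})
      ?_ ?_ (qx.append (w.append qy.reverse)) ?_ (px.reverse.append py) ?_ ?_ ?_
    · rw [Set.disjoint_left]
      intro z h1 h2
      simp only [Set.mem_ofPred_eq] at h1 h2
      omega
    · intro a ha b hb hab
      simp only [Set.mem_ofPred_eq] at ha hb
      have h1 := hc.dist_triangle (u := c) (v := b) (w := a)
      rw [dist_eq_one_iff_adj.2 hab.symm] at h1
      omega
    · intro z hz
      simp only [Walk.mem_support_append_iff, Walk.support_reverse, List.mem_reverse] at hz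
      simp only [Set.mem_ofPred_eq]
      rcases hz with hz | hz | hz
      · have := hqx z hz; tauto
      · have := hw z hz; tauto
      · have := hqy z hz; tauto
    · intro z hz
      simp only [Walk.mem_support_append_iff, Walk.support_reverse, List.mem_reverse] at hz
      simp only [Set.mem_ofPred_eq]
      rcases hz with hz | hz
      · have := hpx z hz; tauto
      · have := hpy z hz; tauto
    · simp [hx]
    · simp [hy]
  have hd : G.dist x y ≤ 1 := by
    rcases hxy with rfl | h
    · simp
    · exact (dist_eq_one_iff_adj.2 h).le
  have h1 := hc.dist_triangle (u := x) (v := y) (w := v)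
  have h2 := G.dist_comm (u := u) (v := x)
  exact ⟨x, hx.le, by omega⟩

/-- Either a geodesic meets a ball, or there is a walk outside that ball. -/
theorem Connected.exists_between_or_walk (hc : G.Connected) (c u v : V) (r : ℕ) :
    (∃ b, G.dist c b ≤ r ∧ G.dist u b + G.dist b v = G.dist u v) ∨
      ∃ w : G.Walk u v, ∀ z ∈ w.support, r < G.dist c z := by
  classical
  obtain ⟨p, hp⟩ := hc.exists_walk_length_eq_dist u v
  by_cases h : ∃ b ∈ p.support, G.dist c b ≤ r
  · obtain ⟨b, hb, hbr⟩ := h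
    left
    refine ⟨b, hbr, ?_⟩
    have h1 := dist_le (p.takeUntil b hb)
    have h2 := dist_le (p.dropUntil b hb)
    have h3 := hc.dist_triangle (u := u) (v := b) (w := v)
    have h4 := congrArg Walk.length (p.take_spec hb)
    rw [Walk.length_append] at h4
    omega
  · push Not at h
    exact Or.inr ⟨p, h⟩

theorem Connected.exists_walk_of_lt (hc : G.Connected) {c u v : V} {r : ℕ}
    (h : G.dist u v + 2 * r < G.dist c u + G.dist c v) :
    ∃ w : G.Walk u v, ∀ z ∈ w.support, r < G.dist c z := by
  refine (hc.exists_between_or_walk c u v r).resolve_left ?_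
  rintro ⟨b, hb, hbe⟩
  have h1 := hc.dist_triangle (u := c) (v := b) (w := u)
  have h2 := hc.dist_triangle (u := c) (v := b) (w := v)
  have h3 := G.dist_comm (u := u) (v := b)
  omega

/-- Chordal graphs are hyperbolic. -/
theorem IsChordal.hyperbolic (hG : G.IsChordal) (hc : G.Connected) {c u v w : V} {r : ℕ}
    (h : G.dist u v + 2 * r < G.dist c u + G.dist c v)
    (h' : G.dist v w + 2 * r < G.dist c v + G.dist c w) :
    G.dist u w + 2 * r ≤ G.dist c u + G.dist c w + 1 := by
  obtain ⟨p, hp⟩ := hc.exists_walk_of_lt h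
  obtain ⟨q, hq⟩ := hc.exists_walk_of_lt h'
  obtain ⟨b, -, hb⟩ := hG.exists_short_detour hc (p.append q) (by
    intro z hz
    rw [Walk.mem_support_append_iff] at hz
    exact hz.elim (hp z) (hq z))
  have := hc.dist_triangle (u := u) (v := b) (w := w)
  omega

/-- A double sweep finds almost the diameter of a chordal graph. -/
theorem IsChordal.dist_le_double_sweep (hG : G.IsChordal) (hc : G.Connected) {a x y : V}
    (hx : ∀ v, G.dist a v ≤ G.dist a x) (hy : ∀ v, G.dist x v ≤ G.dist x y) (u w : V) :
    G.dist u w ≤ G.dist x y + 3 := by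
  by_contra! hcon
  have h1 := hx u
  have h2 := hx w
  have h3 := hy u
  have h4 := hy w
  have h5 := hc.dist_triangle (u := u) (v := a) (w := w)
  have h6 := G.dist_comm (u := u) (v := a)
  have h7 := G.dist_comm (u := u) (v := x)
  obtain ⟨r, hr⟩ : ∃ r, min (G.dist a u) (G.dist a w) + G.dist a x - G.dist x y - 1 ≤ 2 * r + 1 ∧
      2 * r ≤ min (G.dist a u) (G.dist a w) + G.dist a x - G.dist x y - 1 :=
    ⟨(min (G.dist a u) (G.dist a w) + G.dist a x - G.dist x y - 1) / 2, by omega, by omega⟩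
  have h8 := hG.hyperbolic hc (c := a) (u := u) (v := x) (w := w) (r := r) (by omega) (by omega)
  omega

/-- Let `x` be furthest from some vertex, `y` furthest from `x`, and `c` in the middle between `x`
and `y`. Then all eccentricities of a chordal graph can be read off from the distances to the
vertices of the ball of radius `7` around `c`. -/
theorem IsChordal.exists_detour_le_eccentricity (hG : G.IsChordal) (hc : G.Connected) {a x y c : V}
    (hx : ∀ v, G.dist a v ≤ G.dist a x) (hy : ∀ v, G.dist x v ≤ G.dist x y)
    (hm : ∀ v, max (G.dist x c) (G.dist y c) ≤ max (G.dist x v) (G.dist y v)) (u v : V) :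
    ∃ b, G.dist c b ≤ 7 ∧ ∃ z, G.dist u b + G.dist b v ≤ G.dist v z := by
  obtain ⟨m, -, -, hm1, hm2, -, -⟩ :=
    hc.exists_geodesic_split x y (k := G.dist x y / 2) (Nat.div_le_self _ _)
  have h1 := hm m
  have h2 := G.dist_comm (u := m) (v := y)
  have h3 := hc.dist_triangle (u := x) (v := c) (w := y)
  have h4 := G.dist_comm (u := c) (v := x)
  have h5 := G.dist_comm (u := c) (v := y)
  have far : ∀ t, G.dist c t + G.dist x y / 2 ≤ G.dist t x + 4 ∨
      G.dist c t + G.dist x y / 2 ≤ G.dist t y + 4 := by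
    intro t
    by_contra! hcon
    have := G.dist_comm (u := t) (v := x)
    have := hG.hyperbolic hc (c := c) (u := x) (v := t) (w := y) (r := 2) (by omega) (by omega)
    omega
  have hu : G.dist c u ≤ G.dist x y - G.dist x y / 2 + 7 := by
    have := hG.dist_le_double_sweep hc hx hy u x
    have := hG.dist_le_double_sweep hc hx hy u y
    rcases far u with h | h <;> omega
  obtain ⟨z, hz⟩ : ∃ z, G.dist c v + G.dist x y / 2 ≤ G.dist v z + 4 :=
    (far v).elim (fun h => ⟨x, h⟩) (fun h => ⟨y, h⟩)
  rcases hc.exists_between_or_walk c u v 7 with ⟨b, hb, hbe⟩ | ⟨w, hw⟩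
  · exact ⟨b, hb, u, by rw [hbe, dist_comm]⟩
  · obtain ⟨b, hb, hbe⟩ := hG.exists_short_detour hc w hw
    exact ⟨b, hb, z, by omega⟩

/-- In a graph of maximum degree `D`, a ball of radius `r` has at most `(D + 1) ^ r` vertices. -/
theorem Connected.card_ball_le [Fintype V] [DecidableEq V] [DecidableRel G.Adj] (hc : G.Connected)
    {D : ℕ} (hD : ∀ v, G.degree v ≤ D) (c : V) (r : ℕ) :
    (Finset.univ.filter fun v => G.dist c v ≤ r).card ≤ (D + 1) ^ r := by
  induction r with
  | zero =>
    rw [pow_zero, Finset.card_le_one]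
    intro a ha b hb
    simp only [Finset.mem_filter, Finset.mem_univ, true_and, Nat.le_zero, hc.dist_eq_zero_iff]
      at ha hb
    exact ha.symm.trans hb
  | succ r ih =>
    have hsub : (Finset.univ.filter fun v => G.dist c v ≤ r + 1) ⊆
        (Finset.univ.filter fun v => G.dist c v ≤ r).biUnion
          fun v => insert v (G.neighborFinset v) := by
      intro v hv
      simp only [Finset.mem_filter, Finset.mem_univ, true_and] at hv
      simp only [Finset.mem_biUnion, Finset.mem_filter, Finset.mem_univ, true_and,
        Finset.mem_insert, mem_neighborFinset]
      rcases Nat.lt_or_ge r (G.dist c v) with h | h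
      · obtain ⟨x, -, -, hx, hxv, -, -⟩ := hc.exists_geodesic_split c v (k := r) h.le
        exact ⟨x, hx.le, Or.inr (dist_eq_one_iff_adj.1 (by omega))⟩
      · exact ⟨v, h, Or.inl rfl⟩
    refine (Finset.card_le_card hsub).trans (Finset.card_biUnion_le.trans ?_)
    calc _ ≤ ∑ v ∈ Finset.univ.filter fun v => G.dist c v ≤ r, (D + 1) := by
          refine Finset.sum_le_sum fun v _ => (Finset.card_insert_le _ _).trans ?_
          have := hD v
          rw [card_neighborFinset_eq_degree]
          omega
      _ ≤ (D + 1) ^ r * (D + 1) := by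
          rw [Finset.sum_const, smul_eq_mul]
          exact Nat.mul_le_mul_right _ ih
      _ = _ := (pow_succ _ _).symm

end SimpleGraph

namespace WordRAM

@[simp] theorem State.setReg_reg (s : State) (r k r' : ℕ) :
    (s.setReg r k).reg r' = if r' = r then k else s.reg r' :=
  Function.update_apply ..

@[simp] theorem State.setReg_arr (s : State) (r k : ℕ) : (s.setReg r k).arr = s.arr := rfl

@[simp] theorem State.setArr_reg (s : State) (A i k : ℕ) : (s.setArr A i k).reg = s.reg := rfl

@[simp] theorem State.setArr_arr (s : State) (A i k B j : ℕ) :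
    (s.setArr A i k).arr B j = if B = A then if j = i then k else s.arr A j else s.arr B j := by
  by_cases h : B = A
  · subst h
    simp [State.setArr, Function.update_apply]
  · simp [State.setArr, h]

namespace Cmd

/-- The sequential composition of a list of programs. -/
def block : List Cmd → Cmd
  | [] => skip
  | P :: Ps => seq P (block Ps)

/-- The registers to which a program writes. -/
def regs : Cmd → List ℕ
  | skip => []
  | const r _ => [r]
  | copy r _ => [r]
  | add r _ _ => [r]
  | sub r _ _ => [r]
  | load r _ _ => [r]
  | store _ _ _ => []
  | seq P Q => P.regs ++ Q.regs
  | branch _ _ P Q => P.regs ++ Q.regs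
  | loop _ _ P => P.regs

/-- The arrays to which a program writes. -/
def arrs : Cmd → List ℕ
  | store A _ _ => [A]
  | seq P Q => P.arrs ++ Q.arrs
  | branch _ _ P Q => P.arrs ++ Q.arrs
  | loop _ _ P => P.arrs
  | _ => []

end Cmd

/-- The registers and arrays to which `P` does not write agree in `s` and `s'`. -/
structure Frame (P : Cmd) (s s' : State) : Prop where
  reg : ∀ r, r ∉ P.regs → s'.reg r = s.reg r
  arr : ∀ A, A ∉ P.arrs → s'.arr A = s.arr A

theorem Frame.refl (P : Cmd) (s : State) : Frame P s s := ⟨fun _ _ => rfl, fun _ _ => rfl⟩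

theorem Frame.trans {P : Cmd} {s s' s'' : State} (h : Frame P s s') (h' : Frame P s' s'') :
    Frame P s s'' :=
  ⟨fun r hr => (h'.reg r hr).trans (h.reg r hr), fun A hA => (h'.arr A hA).trans (h.arr A hA)⟩

theorem Frame.mono {P Q : Cmd} {s s' : State} (h : Frame P s s') (hr : ∀ r ∈ P.regs, r ∈ Q.regs)
    (hA : ∀ A ∈ P.arrs, A ∈ Q.arrs) : Frame Q s s' :=
  ⟨fun r h' => h.reg r fun e => h' (hr r e), fun A h' => h.arr A fun e => h' (hA A e)⟩

theorem Exec.frame {W : ℕ} {P : Cmd} {s s' : State} {t : ℕ} (h : Exec W P s t s') :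
    Frame P s s' := by
  induction h with
  | skip s => exact Frame.refl _ _
  | const s r k h => exact ⟨fun r' hr => by simp_all [Cmd.regs], fun _ _ => rfl⟩
  | copy s r k h => exact ⟨fun r' hr => by simp_all [Cmd.regs], fun _ _ => rfl⟩
  | add s r k h => exact ⟨fun r' hr => by simp_all [Cmd.regs], fun _ _ => rfl⟩
  | sub s r k h => exact ⟨fun r' hr => by simp_all [Cmd.regs], fun _ _ => rfl⟩
  | load s r k h => exact ⟨fun r' hr => by simp_all [Cmd.regs], fun _ _ => rfl⟩
  | store s A x y h =>
    refine ⟨fun _ _ => rfl, fun B hB => funext fun j => ?_⟩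
    have : B ≠ A := by simpa [Cmd.arrs] using hB
    simp [this]
  | seq _ _ ihP ihQ =>
    exact (ihP.mono (by simp +contextual [Cmd.regs]) (by simp +contextual [Cmd.arrs])).trans
      (ihQ.mono (by simp +contextual [Cmd.regs]) (by simp +contextual [Cmd.arrs]))
  | branch_true _ _ ih =>
    exact ih.mono (by simp +contextual [Cmd.regs]) (by simp +contextual [Cmd.arrs])
  | branch_false _ _ ih =>
    exact ih.mono (by simp +contextual [Cmd.regs]) (by simp +contextual [Cmd.arrs])
  | loop_true _ _ _ ihP ihL => exact (ihP.mono (Q := .loop _ _ _) (fun _ h => h) fun _ h => h).trans ihL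
  | loop_false _ => exact Frame.refl _ _

/-- Started in `s`, the program `P` halts within `T` steps in a state which satisfies `Q`. -/
def Total (W : ℕ) (P : Cmd) (T : ℕ) (s : State) (Q : State → Prop) : Prop :=
  ∃ t s', Exec W P s t s' ∧ t ≤ T ∧ Q s'

section rules

variable {W T T₁ T₂ : ℕ} {P P' : Cmd} {Ps : List Cmd} {s : State} {Q R : State → Prop}

theorem Total.mono (h : Total W P T s Q) (hT : T ≤ T₁) (hQ : ∀ s', Q s' → Frame P s s' → R s') :
    Total W P T₁ s R := by
  obtain ⟨t, s', he, ht, hq⟩ := h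
  exact ⟨t, s', he, ht.trans hT, hQ s' hq he.frame⟩

theorem Total.of_le (h : Total W P T s Q) (hT : T ≤ T₁) : Total W P T₁ s Q :=
  h.mono hT fun _ hq _ => hq

theorem Total.nil (h : Q s) : Total W (.block []) 1 s Q := ⟨1, s, .skip s, le_rfl, h⟩

theorem Total.cons (h : Total W P T₁ s R)
    (h' : ∀ s', R s' → Frame P s s' → Total W (.block Ps) T₂ s' Q) :
    Total W (.block (P :: Ps)) (T₁ + T₂) s Q := by
  obtain ⟨t, s', he, ht, hr⟩ := h
  obtain ⟨t', s'', he', ht', hq⟩ := h' s' hr he.frame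
  exact ⟨t + t', s'', .seq he he', add_le_add ht ht', hq⟩

theorem Total.step {s' : State} (h : Exec W P s 1 s') (h' : Total W (.block Ps) T s' Q) :
    Total W (.block (P :: Ps)) (1 + T) s Q := by
  obtain ⟨t', s'', he', ht', hq⟩ := h'
  exact ⟨1 + t', s'', .seq h he', add_le_add le_rfl ht', hq⟩

theorem Total.const {r k : ℕ} (h : k ≤ W) (h' : Total W (.block Ps) T (s.setReg r k) Q) :
    Total W (.block (.const r k :: Ps)) (1 + T) s Q := .step (.const s r k h) h'

theorem Total.copy {r x : ℕ} (h : s.reg x ≤ W)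
    (h' : Total W (.block Ps) T (s.setReg r (s.reg x)) Q) :
    Total W (.block (.copy r x :: Ps)) (1 + T) s Q := .step (.copy s r x h) h'

theorem Total.add {r x y : ℕ} (h : s.reg x + s.reg y ≤ W)
    (h' : Total W (.block Ps) T (s.setReg r (s.reg x + s.reg y)) Q) :
    Total W (.block (.add r x y :: Ps)) (1 + T) s Q := .step (.add s r x y h) h'

theorem Total.sub {r x y : ℕ} (h : s.reg x - s.reg y ≤ W)
    (h' : Total W (.block Ps) T (s.setReg r (s.reg x - s.reg y)) Q) :
    Total W (.block (.sub r x y :: Ps)) (1 + T) s Q := .step (.sub s r x y h) h'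

theorem Total.load {r A x : ℕ} (h : s.arr A (s.reg x) ≤ W)
    (h' : Total W (.block Ps) T (s.setReg r (s.arr A (s.reg x))) Q) :
    Total W (.block (.load r A x :: Ps)) (1 + T) s Q := .step (.load s r A x h) h'

theorem Total.store {A x y : ℕ} (h : s.reg y ≤ W)
    (h' : Total W (.block Ps) T (s.setArr A (s.reg x) (s.reg y)) Q) :
    Total W (.block (.store A x y :: Ps)) (1 + T) s Q := .step (.store s A x y h) h'

theorem Total.branch {x y : ℕ} (h : s.reg x < s.reg y → Total W P T₁ s Q)
    (h' : ¬ s.reg x < s.reg y → Total W P' T₂ s Q) :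
    Total W (.branch x y P P') (T₁ + T₂ + 1) s Q := by
  by_cases hxy : s.reg x < s.reg y
  · obtain ⟨t, s', he, ht, hq⟩ := h hxy
    exact ⟨t + 1, s', .branch_true hxy he, by omega, hq⟩
  · obtain ⟨t, s', he, ht, hq⟩ := h' hxy
    exact ⟨t + 1, s', .branch_false hxy he, by omega, hq⟩

theorem Total.branch_true {x y : ℕ} (hxy : s.reg x < s.reg y) (h : Total W P T s Q) :
    Total W (.branch x y P P') (T + 1) s Q := by
  obtain ⟨t, s', he, ht, hq⟩ := h
  exact ⟨t + 1, s', .branch_true hxy he, by omega, hq⟩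

theorem Total.branch_false {x y : ℕ} (hxy : ¬ s.reg x < s.reg y) (h : Total W P' T s Q) :
    Total W (.branch x y P P') (T + 1) s Q := by
  obtain ⟨t, s', he, ht, hq⟩ := h
  exact ⟨t + 1, s', .branch_false hxy he, by omega, hq⟩

/-- The rule for a loop with `N` rounds, each of at most `C` steps up to the growth of the
potential `φ`. -/
theorem Total.loop_amortized {x y : ℕ} (I : ℕ → State → Prop) (φ : State → ℕ) (N : ℕ) {C B : ℕ}
    (h0 : I 0 s)
    (hstep : ∀ i s', i < N → I i s' → Frame P s s' → s'.reg x < s'.reg y ∧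
      ∃ T, Total W P T s' fun s'' => I (i + 1) s'' ∧ T + φ s' ≤ C + φ s'')
    (hend : ∀ s', I N s' → Frame P s s' → ¬ s'.reg x < s'.reg y ∧ φ s' ≤ B) :
    Total W (.loop x y P) (N * (C + 1) + B + 1) s (I N) := by
  have key : ∀ k i s', i + k = N → I i s' → Frame P s s' → ∃ t s'',
      Exec W (.loop x y P) s' t s'' ∧ t + φ s' ≤ k * (C + 1) + B + 1 ∧ I N s'' := by
    intro k
    induction k with
    | zero =>
      intro i s' hi hI hf
      obtain rfl : i = N := by omega
      exact ⟨1, s', .loop_false (hend s' hI hf).1, by have := (hend s' hI hf).2; omega, hI⟩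
    | succ k ih =>
      intro i s' hi hI hf
      obtain ⟨hxy, T, t, s₁, he, ht, hI₁, hφ⟩ := hstep i s' (by omega) hI hf
      obtain ⟨t', s₂, he', ht', hI₂⟩ := ih (i + 1) s₁ (by omega) hI₁ (hf.trans he.frame)
      refine ⟨t + t' + 1, s₂, .loop_true hxy he he', ?_, hI₂⟩
      rw [Nat.succ_mul]
      omega
  obtain ⟨t, s', he, ht, hI⟩ := key N 0 s (by omega) h0 (Frame.refl _ _)
  exact ⟨t, s', he, by omega, hI⟩

/-- The rule for a loop with `N` rounds, each of at most `T` steps. -/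
theorem Total.loop {x y : ℕ} (I : ℕ → State → Prop) (N : ℕ) (h0 : I 0 s)
    (hstep : ∀ i s', i < N → I i s' → Frame P s s' →
      s'.reg x < s'.reg y ∧ Total W P T s' (I (i + 1)))
    (hend : ∀ s', I N s' → Frame P s s' → ¬ s'.reg x < s'.reg y) :
    Total W (.loop x y P) (N * (T + 1) + 1) s (I N) :=
  Total.loop_amortized I (fun _ => 0) N (B := 0) h0
    (fun i s' hi hI hf => ⟨(hstep i s' hi hI hf).1, T,
      (hstep i s' hi hI hf).2.mono le_rfl fun _ h _ => ⟨h, le_rfl⟩⟩)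
    fun s' hI hf => ⟨hend s' hI hf, le_rfl⟩

end rules

end WordRAM

namespace SimpleGraph

variable {V : Type*} {G : SimpleGraph V}

theorem Connected.exists_adj_dist_succ (hc : G.Connected) {c v : V} (h : v ≠ c) :
    ∃ w, G.Adj w v ∧ G.dist c w + 1 = G.dist c v := by
  have hpos := hc.pos_dist_of_ne h.symm
  obtain ⟨w, -, -, hw, hwv, -, -⟩ := hc.exists_geodesic_split c v (k := G.dist c v - 1) (by omega)
  exact ⟨w, dist_eq_one_iff_adj.1 (by omega), by omega⟩

theorem Adj.dist_le_succ (hc : G.Connected) {c v w : V} (h : G.Adj v w) :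
    G.dist c w ≤ G.dist c v + 1 := by
  have := hc.dist_triangle (u := c) (v := v) (w := w)
  rwa [dist_eq_one_iff_adj.2 h] at this

theorem Connected.dist_lt_card [Fintype V] (hc : G.Connected) (u v : V) :
    G.dist u v < Fintype.card V := by
  obtain ⟨p, hp, hl⟩ := hc.exists_path_of_dist u v
  exact hl ▸ hp.length_lt

/-- A list of vertices which contains `c` and all neighbours of its vertices is complete. -/
theorem Connected.mem_of_closed (hc : G.Connected) {c : V} {l : List V} (hl : c ∈ l)
    (h : ∀ u ∈ l, ∀ w, G.Adj u w → w ∈ l) (v : V) : v ∈ l := by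
  obtain ⟨p⟩ := hc.preconnected c v
  induction p with
  | nil => exact hl
  | cons hadj _ ih => exact ih (h _ hl _ hadj)

/-- In a breadth-first search, a vertex that is not processed is at least as far away as the head
of the queue. -/
theorem Connected.dist_head_le (hc : G.Connected) {c u : V} {done todo : List V}
    (hmem : c ∈ done ++ todo) (h : ∀ x ∈ done, ∀ w, G.Adj x w → w ∈ done ++ todo)
    (hu : ∀ x ∈ todo, G.dist c u ≤ G.dist c x) :
    ∀ v, v ∉ done → G.dist c u ≤ G.dist c v := by
  suffices ∀ k v, G.dist c v = k → v ∉ done → G.dist c u ≤ G.dist c v from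
    fun v => this _ v rfl
  intro k
  induction k with
  | zero =>
    intro v hk hv
    obtain rfl := hc.dist_eq_zero_iff.1 hk
    exact hu _ ((List.mem_append.1 hmem).resolve_left hv)
  | succ k ih =>
    intro v hk hv
    obtain ⟨w, hwv, hw⟩ := hc.exists_adj_dist_succ (c := c) (v := v)
      (fun e => by rw [e, dist_self] at hk; omega)
    by_cases hd : w ∈ done
    · exact hu _ ((List.mem_append.1 (h w hd v hwv)).resolve_left hv)
    · have := ih w (by omega) hd
      omega

/-- A new vertex that is found in a breadth-first search is one step further away than the
head of the queue. -/
theorem Connected.dist_discovered (hc : G.Connected) {c u w : V} {done todo : List V}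
    (hmem : c ∈ done ++ todo) (h : ∀ x ∈ done, ∀ w, G.Adj x w → w ∈ done ++ todo)
    (hu : ∀ x ∈ todo, G.dist c u ≤ G.dist c x) (hw : w ∉ done ++ todo) (huw : G.Adj u w) :
    G.dist c w = G.dist c u + 1 := by
  refine le_antisymm (huw.dist_le_succ hc) ?_
  obtain ⟨z, hzw, hz⟩ := hc.exists_adj_dist_succ (c := c) (v := w) (fun e => hw (e ▸ hmem))
  have hzd : z ∉ done := fun e => hw (h z e w hzw)
  have := hc.dist_head_le hmem h hu z hzd
  omega

end SimpleGraph

namespace WordRAM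

namespace AdjLists

variable {n : ℕ} {G : SimpleGraph (Fin n)} (L : AdjLists G)

theorem length_nbrs [DecidableRel G.Adj] (v : Fin n) : (L.nbrs v).length = G.degree v := by
  rw [← List.toFinset_card_of_nodup (L.nodup v), ← G.card_neighborFinset_eq_degree]
  congr 1
  ext w
  simp [L.mem_nbrs]

theorem inputState_offset_succ (v : Fin n) :
    L.inputState.arr 0 (v + 1) = L.inputState.arr 0 v + (L.nbrs v).length := by
  have h1 : v.val + 1 ≤ n := v.isLt
  have h2 : v.val ≤ n := v.isLt.le
  simp only [inputState, if_true, if_pos h1, if_pos h2]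
  have : (Finset.univ.filter fun w : Fin n => w.val < v.val + 1) =
      insert v (Finset.univ.filter fun w : Fin n => w.val < v.val) := by
    ext w
    simp only [Finset.mem_filter, Finset.mem_univ, true_and, Finset.mem_insert, Fin.ext_iff]
    omega
  rw [this, Finset.sum_insert (by simp), add_comm]

theorem inputState_offset_eq (i : ℕ) (hi : i ≤ n) :
    L.inputState.arr 0 i = (((List.finRange n).take i).flatMap L.nbrs).length := by
  induction i with
  | zero => simp [inputState]
  | succ i ih =>
    rw [L.inputState_offset_succ ⟨i, hi⟩, ih (by omega),
      List.take_add_one, List.getElem?_eq_getElem (by simpa using hi)]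
    simp

theorem inputState_offset_le {D : ℕ} (hD : ∀ v, (L.nbrs v).length ≤ D) (i : ℕ) :
    L.inputState.arr 0 i ≤ n * D := by
  simp only [inputState, if_true]
  split_ifs
  · calc _ ≤ ∑ v : Fin n with v.val < i, D := Finset.sum_le_sum fun v _ => hD v
      _ ≤ ∑ v : Fin n, D := Finset.sum_le_sum_of_subset (Finset.filter_subset _ _)
      _ = n * D := by simp
  · exact Nat.zero_le _

theorem inputState_nbrs (v : Fin n) (j : ℕ) (hj : j < (L.nbrs v).length) :
    L.inputState.arr 1 (L.inputState.arr 0 v + j) = (L.nbrs v)[j] := by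
  rw [L.inputState_offset_eq v v.isLt.le]
  simp only [inputState, if_neg one_ne_zero, if_true]
  have hsplit : (List.finRange n).flatMap L.nbrs =
      ((List.finRange n).take v).flatMap L.nbrs ++
        (L.nbrs v ++ ((List.finRange n).drop (v + 1)).flatMap L.nbrs) := by
    conv_lhs => rw [← List.take_append_drop v.val (List.finRange n)]
    rw [List.drop_eq_getElem_cons (by simp), List.flatMap_append, List.flatMap_cons]
    simp
  rw [hsplit, List.getD_eq_getElem?_getD, List.getElem?_map,
    List.getElem?_append_right (by omega), Nat.add_sub_cancel_left,
    List.getElem?_append_left hj, List.getElem?_eq_getElem hj]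
  rfl

end AdjLists

end WordRAM

namespace WordRAM

open Cmd

/-- Look at one neighbour in a breadth-first search. -/
def bfsScan : Cmd := block [load 9 1 7, add 10 2 9, load 11 3 10,
  branch 13 11 skip (block [store 3 10 12, store 4 5 9, add 5 5 1]), add 7 7 1]

/-- Process the head of the queue in a breadth-first search. -/
def bfsVisit : Cmd := block [load 6 4 4, add 10 2 6, load 12 3 10, add 12 12 1, load 7 0 6,
  add 10 6 1, load 8 0 10, loop 7 8 bfsScan, add 4 4 1]

/-- Breadth-first search from the vertex in register `3`. The distances, increased by one,
go to the cells of array `3` from the index in register `2` on, and this index is moved on.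
The visited vertices are listed in array `4`, and register `6` is left with the last one. -/
def bfs : Cmd := block [const 4 0, const 5 1, store 4 13 3, add 10 2 3, store 3 10 1,
  loop 4 5 bfsVisit, add 2 2 0]

variable {n : ℕ} {G : SimpleGraph (Fin n)}

/-- The part of the memory that holds the graph and the constants `n`, `1` and `0`. -/
structure Setup (L : AdjLists G) (s : State) : Prop where
  size : s.reg 0 = n
  one : s.reg 1 = 1
  zero : s.reg 13 = 0
  offsets : s.arr 0 = L.inputState.arr 0
  lists : s.arr 1 = L.inputState.arr 1

theorem Setup.frame {L : AdjLists G} {P : Cmd} {s s' : State} (h : Setup L s) (hf : Frame P s s')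
    (h0 : 0 ∉ P.regs) (h1 : 1 ∉ P.regs) (h13 : 13 ∉ P.regs) (hA : 0 ∉ P.arrs) (hB : 1 ∉ P.arrs) :
    Setup L s' :=
  ⟨(hf.reg 0 h0).trans h.size, (hf.reg 1 h1).trans h.one, (hf.reg 13 h13).trans h.zero,
    (hf.arr 0 hA).trans h.offsets, (hf.arr 1 hB).trans h.lists⟩

/-- The memory during a breadth-first search from `c`, when the vertices of `q` were visited. -/
structure Queue (G : SimpleGraph (Fin n)) (c : Fin n) (base : ℕ) (F : ℕ → ℕ) (q : List (Fin n))
    (s : State) : Prop where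
  nodup : q.Nodup
  source : c ∈ q
  sorted : q.Pairwise fun x y => G.dist c x ≤ G.dist c y
  offset : s.reg 2 = base
  tail : s.reg 5 = q.length
  queue : ∀ i (h : i < q.length), s.arr 4 i = q[i]
  dist : ∀ v ∈ q, s.arr 3 (base + v) = G.dist c v + 1
  unseen : ∀ v ∉ q, s.arr 3 (base + v) = 0
  old : ∀ i, (∀ v : Fin n, i ≠ base + v) → s.arr 3 i = F i

section

variable {c : Fin n} {base : ℕ} {F : ℕ → ℕ} {q : List (Fin n)} {s s' : State}

theorem Queue.length_le (h : Queue G c base F q s) : q.length ≤ n := by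
  simpa using h.nodup.length_le_card

theorem Queue.congr (h : Queue G c base F q s) (h2 : s'.reg 2 = s.reg 2) (h5 : s'.reg 5 = s.reg 5)
    (h3 : s'.arr 3 = s.arr 3) (h4 : s'.arr 4 = s.arr 4) : Queue G c base F q s' where
  nodup := h.nodup
  source := h.source
  sorted := h.sorted
  offset := h2.trans h.offset
  tail := h5.trans h.tail
  queue := h4 ▸ h.queue
  dist := h3 ▸ h.dist
  unseen := h3 ▸ h.unseen
  old := h3 ▸ h.old

theorem Queue.push (h : Queue G c base F q s) {w : Fin n} (hw : w ∉ q)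
    (hle : ∀ x ∈ q, G.dist c x ≤ G.dist c w) (h2 : s'.reg 2 = s.reg 2)
    (h5 : s'.reg 5 = s.reg 5 + 1)
    (h3 : ∀ i, s'.arr 3 i = if i = base + w then G.dist c w + 1 else s.arr 3 i)
    (h4 : ∀ i, s'.arr 4 i = if i = q.length then w.val else s.arr 4 i) :
    Queue G c base F (q ++ [w]) s' where
  nodup := by
    rw [List.nodup_append]
    exact ⟨h.nodup, List.nodup_singleton _, by rintro a ha b hb rfl; simp_all⟩
  source := List.mem_append_left _ h.source
  sorted := by
    rw [List.pairwise_append]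
    exact ⟨h.sorted, List.pairwise_singleton _ _, by simpa using hle⟩
  offset := h2.trans h.offset
  tail := by rw [h5, h.tail]; simp
  queue := by
    intro i hi
    rw [h4]
    split_ifs with e
    · subst e; simp
    · simp only [List.length_append, List.length_singleton] at hi
      rw [h.queue i (by omega), List.getElem_append_left]
  dist := by
    intro v hv
    rw [h3]
    split_ifs with e
    · rw [show v = w from Fin.ext (by omega)]
    · refine h.dist v ?_
      rcases List.mem_append.1 hv with hv | hv
      · exact hv
      · rw [List.mem_singleton.1 hv] at e
        exact absurd rfl e
  unseen := by
    intro v hv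
    rw [List.mem_append, List.mem_singleton, not_or] at hv
    rw [h3, if_neg (fun e => hv.2 (Fin.ext (by omega)))]
    exact h.unseen v hv.1
  old := by
    intro i hi
    rw [h3, if_neg (hi w)]
    exact h.old i hi

end

variable {L : AdjLists G} {c : Fin n} {base : ℕ} {F : ℕ → ℕ} {W D : ℕ} {s : State}

theorem total_bfsScan (hc : G.Connected) {done rest ext : List (Fin n)} {u w : Fin n} {k : ℕ}
    (hS : Setup L s) (hq : Queue G c base F (done ++ u :: (rest ++ ext)) s)
    (hclosed : ∀ x ∈ done, ∀ z, G.Adj x z → z ∈ done ++ u :: (rest ++ ext))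
    (hle : ∀ x ∈ u :: (rest ++ ext), G.dist c x ≤ G.dist c u + 1)
    (huw : G.Adj u w) (h7 : s.reg 7 = k) (hk : s.arr 1 k = w)
    (h12 : s.reg 12 = G.dist c u + 2) (hW : base + n + 2 ≤ W) (hkW : k + 1 ≤ W) :
    Total W bfsScan 11 s fun s' => s'.reg 7 = k + 1 ∧ ∃ e : List (Fin n),
      Queue G c base F (done ++ u :: (rest ++ (ext ++ e))) s' ∧
      w ∈ done ++ u :: (rest ++ (ext ++ e)) ∧
      ∀ x ∈ u :: (rest ++ (ext ++ e)), G.dist c x ≤ G.dist c u + 1 := by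
  have hwn := w.isLt
  have hsorted := hq.sorted
  rw [List.pairwise_append, List.pairwise_cons] at hsorted
  have hu : ∀ x ∈ u :: (rest ++ ext), G.dist c u ≤ G.dist c x := by
    intro x hx
    rcases List.mem_cons.1 hx with rfl | hx
    · exact le_rfl
    · exact hsorted.2.1.1 x hx
  have hdw : G.dist c w + 1 ≤ n := by simpa using hc.dist_lt_card c w
  have hdu : G.dist c u + 1 ≤ n := by simpa using hc.dist_lt_card c u
  have hd : s.arr 3 (base + w) ≤ n := by
    by_cases hm : w ∈ done ++ u :: (rest ++ ext)
    · rw [hq.dist w hm]; omega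
    · rw [hq.unseen w hm]; omega
  have hlen := hq.length_le
  unfold bfsScan
  refine Total.of_le (T := 1 + (1 + (1 + ((1 + (1 + (1 + (1 + 1))) + 1) + (1 + 1)))))
    (Total.load (by simp [h7, hk]; omega) <| Total.add (by simp [h7, hk, hq.offset]; omega) <|
    Total.load (by simp [h7, hk, hq.offset]; omega) <|
    Total.cons (R := fun s' => ∃ e : List (Fin n),
      Queue G c base F (done ++ u :: (rest ++ (ext ++ e))) s' ∧
      w ∈ done ++ u :: (rest ++ (ext ++ e)) ∧
      ∀ x ∈ u :: (rest ++ (ext ++ e)), G.dist c x ≤ G.dist c u + 1)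
    (Total.branch ?_ ?_) ?_) le_rfl
  · intro h
    simp only [State.setReg_reg, State.setReg_arr, h7, hk, hq.offset, hS.zero] at h
    simp at h
    have hm : w ∈ done ++ u :: (rest ++ ext) := by
      by_contra hm
      rw [hq.unseen w hm] at h
      omega
    refine ⟨1, _, .skip _, le_rfl, [], ?_, ?_, ?_⟩
    · rw [List.append_nil]
      exact hq.congr (by simp) (by simp) rfl rfl
    · rwa [List.append_nil]
    · rwa [List.append_nil]
  · intro h
    simp only [State.setReg_reg, State.setReg_arr, h7, hk, hq.offset, hS.zero] at h
    simp at h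
    have hm : w ∉ done ++ u :: (rest ++ ext) := by
      intro hm
      rw [hq.dist w hm] at h
      omega
    have hdist := hc.dist_discovered hq.source hclosed hu hm huw
    have hle' : ∀ x ∈ done ++ u :: (rest ++ ext), G.dist c x ≤ G.dist c w := by
      intro x hx
      rw [hdist]
      rcases List.mem_append.1 hx with hx | hx
      · exact (hsorted.2.2 x hx u (by simp)).trans (Nat.le_succ _)
      · exact hle x hx
    have hn : (done ++ u :: (rest ++ ext)).length + 1 ≤ n := by
      have : (w :: (done ++ u :: (rest ++ ext))).Nodup := List.nodup_cons.2 ⟨hm, hq.nodup⟩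
      simpa using this.length_le_card
    refine Total.store (by simp [h12]; omega) <| Total.store (by simp [h7, hk]; omega) <|
      Total.add (by simp only [State.setReg_reg, State.setArr_reg]; simp [hS.one, hq.tail] at hn ⊢; omega) <|
      Total.nil ⟨[w], ?_, ?_, ?_⟩
    · have := hq.push
        (s' := (((((s.setReg 9 w).setReg 10 (base + w)).setReg 11 0).setArr 3 (base + w)
          (G.dist c w + 1)).setArr 4 (done ++ u :: (rest ++ ext)).length w).setReg 5
          ((done ++ u :: (rest ++ ext)).length + 1)) hm hle' (by simp) (by simp [hq.tail])
        (by intro i; simp) (by intro i; simp)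
      rw [show done ++ u :: (rest ++ (ext ++ [w])) = done ++ u :: (rest ++ ext) ++ [w] by simp]
      refine this.congr ?_ ?_ ?_ ?_
      · simp
      · simp [hq.tail, hS.one]
      · funext i; simp [h7, hk, hq.offset, hdist, h12]
      · funext i; simp [h7, hk, hq.tail]
    · simp
    · intro x hx
      rw [← List.append_assoc, ← List.cons_append, List.mem_append, List.mem_singleton] at hx
      rcases hx with hx | rfl
      · exact hle x hx
      · exact hdist.le
  · rintro s' ⟨e, h1, h2, h3⟩ hf
    have e7 := hf.reg 7 (by decide)
    have e1 := hf.reg 1 (by decide)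
    simp at e7 e1
    refine Total.add (by rw [e7, e1, h7, hS.one]; exact hkW) <| Total.nil ⟨?_, e, ?_, h2, h3⟩
    · simp [e7, e1, h7, hS.one]
    · exact h1.congr (by simp) (by simp) rfl rfl

/-- The memory during a breadth-first search from `c`, when `h` vertices were processed. -/
def Visited (G : SimpleGraph (Fin n)) (c : Fin n) (base : ℕ) (F : ℕ → ℕ) (h : ℕ) (s : State) :
    Prop :=
  ∃ done todo : List (Fin n), done.length = h ∧ s.reg 4 = h ∧ Queue G c base F (done ++ todo) s ∧
    (∀ x ∈ done, ∀ z, G.Adj x z → z ∈ done ++ todo) ∧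
    (∀ u rest, todo = u :: rest → ∀ x ∈ todo, G.dist c x ≤ G.dist c u + 1) ∧
    ∀ d u, done = d ++ [u] → s.reg 6 = u.val

theorem total_bfsVisit (hc : G.Connected) {h : ℕ} (hh : h < n) (hS : Setup L s)
    (hv : Visited G c base F h s) (hW : base + n + 2 ≤ W) (hD : ∀ v, (L.nbrs v).length ≤ D)
    (hDW : n * D + 1 ≤ W) :
    s.reg 4 < s.reg 5 ∧
      Total W bfsVisit (D * 12 + 11) s (Visited G c base F (h + 1)) := by
  obtain ⟨done, todo, hlen, h4, hq, hclosed, hle, -⟩ := hv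
  cases todo with
  | nil =>
    exfalso
    rw [List.append_nil] at hq hclosed
    have hall : ∀ v, v ∈ done := hc.mem_of_closed hq.source hclosed
    have : (List.finRange n).length ≤ done.length :=
      ((List.nodup_finRange n).subperm fun v _ => hall v).length_le
    rw [List.length_finRange] at this
    omega
  | cons u rest =>
  have hle := hle u rest rfl
  have hun := u.isLt
  have hlen' := hq.length_le
  rw [List.length_append, List.length_cons] at hlen'
  have hQ : s.arr 4 (s.reg 4) = u := by
    rw [h4, hq.queue h (by simp; omega)]
    simp [← hlen]
  have hDu : s.arr 3 (base + u) = G.dist c u + 1 := hq.dist u (by simp)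
  have hdu : G.dist c u + 1 ≤ n := by simpa using hc.dist_lt_card c u
  have hoff := L.inputState_offset_succ u
  have hoffle := L.inputState_offset_le hD (u.val + 1)
  refine ⟨by rw [h4, hq.tail]; simp; omega, ?_⟩
  unfold bfsVisit
  refine Total.of_le
    (T := 1 + (1 + (1 + (1 + (1 + (1 + (1 + ((L.nbrs u).length * (11 + 1) + 1 + (1 + 1)))))))))
    (Total.load (by rw [hQ]; omega) <|
    Total.add (by simp [hQ, hq.offset]; omega) <|
    Total.load (by simp [hQ, hq.offset, hDu]; omega) <|
    Total.add (by simp [hQ, hq.offset, hDu, hS.one]; omega) <|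
    Total.load (by simp [hQ, hS.offsets]; omega) <|
    Total.add (by simp [hQ, hS.one]; omega) <|
    Total.load (by simp [hQ, hS.offsets, hS.one]; omega) <|
    Total.cons (Total.loop (T := 11) (fun j s' => s'.reg 7 = L.inputState.arr 0 u + j ∧
      ∃ e : List (Fin n), Queue G c base F (done ++ u :: (rest ++ e)) s' ∧
        (∀ x ∈ (L.nbrs u).take j, x ∈ done ++ u :: (rest ++ e)) ∧
        ∀ x ∈ u :: (rest ++ e), G.dist c x ≤ G.dist c u + 1) (L.nbrs u).length ?_ ?_ ?_)
      ?_) ?_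
  · refine ⟨by simp [hQ, hS.offsets], [], ?_, by simp, by simpa using hle⟩
    rw [List.append_nil]
    exact hq.congr (by simp) (by simp) rfl rfl
  · rintro j s' hj ⟨h7, e, he, htake, hdist⟩ hf
    have hS' : Setup L s' := by
      refine Setup.frame (P := bfsScan) ⟨?_, ?_, ?_, ?_, ?_⟩ hf (by decide) (by decide) (by decide)
        (by decide) (by decide)
      · simpa using hS.size
      · simpa using hS.one
      · simpa using hS.zero
      · simpa using hS.offsets
      · simpa using hS.lists
    have e8 := hf.reg 8 (by decide)
    have e12 := hf.reg 12 (by decide)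
    simp only [State.setReg_reg, State.setReg_arr, hQ, hS.one, hS.offsets, hq.offset] at e8 e12
    simp at e8 e12
    refine ⟨by omega, (total_bfsScan hc (w := (L.nbrs u)[j]) hS' he ?_ hdist ?_ h7 ?_ (by omega) hW
      (by omega)).mono le_rfl ?_⟩
    · intro x hx z hz
      have := hclosed x hx z hz
      simp only [List.mem_append, List.mem_cons] at this ⊢
      tauto
    · exact (L.mem_nbrs u _).1 (List.getElem_mem _)
    · rw [hS'.lists]
      exact L.inputState_nbrs u j hj
    · rintro s'' ⟨h7', e', hq', hw, hd'⟩ -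
      refine ⟨by omega, e ++ e', hq', ?_, hd'⟩
      intro x hx
      rw [List.take_add_one, List.getElem?_eq_getElem hj, List.mem_append] at hx
      rcases hx with hx | hx
      · have := htake x hx
        simp only [List.mem_append, List.mem_cons] at this ⊢
        tauto
      · simp only [Option.toList_some, List.mem_singleton] at hx
        exact hx ▸ hw
  · rintro s' ⟨h7, -⟩ hf
    have e8 := hf.reg 8 (by decide)
    simp only [State.setReg_reg, State.setReg_arr, hQ, hS.one, hS.offsets] at e8
    simp at e8
    omega
  · rintro s' ⟨h7, e, he, htake, hdist⟩ hf
    have e4 := hf.reg 4 (by decide)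
    have e1 := hf.reg 1 (by decide)
    have e6 := hf.reg 6 (by decide)
    simp [h4, hS.one] at e4 e1 e6
    rw [h4] at hQ
    rw [hQ] at e6
    refine Total.add (by rw [e4, e1]; omega) <| Total.nil
      ⟨done ++ [u], rest ++ e, by simp [hlen], by simp [e4, e1], ?_, ?_, ?_, ?_⟩
    · rw [List.append_assoc, List.singleton_append]
      exact he.congr (by simp) (by simp) rfl rfl
    · intro x hx z hz
      rw [List.append_assoc, List.singleton_append]
      rcases List.mem_append.1 hx with hx | hx
      · have := hclosed x hx z hz
        simp only [List.mem_append, List.mem_cons] at this ⊢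
        tauto
      · rw [List.mem_singleton] at hx
        subst hx
        exact htake z (by rw [List.take_length]; exact (L.mem_nbrs _ _).2 hz)
    · intro v r hvr x hx
      have h1 := hdist x (List.mem_cons_of_mem _ hx)
      have h2 := he.sorted
      rw [List.pairwise_append, List.pairwise_cons] at h2
      have h3 := h2.2.1.1 v (by rw [hvr]; simp)
      omega
    · intro d v hdv
      have := List.append_inj_right' hdv rfl
      rw [List.singleton_inj] at this
      subst this
      simpa using e6
  · have := hD u
    omega

theorem total_bfs (hc : G.Connected) (hS : Setup L s) (h3 : s.reg 3 = c) (h2 : s.reg 2 = base)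
    (hzero : ∀ i, base ≤ i → s.arr 3 i = 0) (hW : base + n + 2 ≤ W)
    (hD : ∀ v, (L.nbrs v).length ≤ D) (hDW : n * D + 1 ≤ W) :
    Total W bfs (n * (D * 12 + 12) + 8) s fun s' => s'.reg 2 = base + n ∧
      (∀ v : Fin n, s'.arr 3 (base + v) = G.dist c v + 1) ∧
      (∀ i < base, s'.arr 3 i = s.arr 3 i) ∧ (∀ i, base + n ≤ i → s'.arr 3 i = 0) ∧
      (∃ u : Fin n, s'.reg 6 = u ∧ ∀ v, G.dist c v ≤ G.dist c u) ∧
      ∃ q : List (Fin n), q.length = n ∧ (∀ v, v ∈ q) ∧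
        q.Pairwise (fun x y => G.dist c x ≤ G.dist c y) ∧
        ∀ i (h : i < q.length), s'.arr 4 i = q[i] := by
  have hcn := c.isLt
  have hz0 := hS.zero
  have ho1 := hS.one
  have hend : ∀ s', Visited G c base (s.arr 3) n s' → ∃ q : List (Fin n),
      Queue G c base (s.arr 3) q s' ∧ q.length = n ∧ (∀ v, v ∈ q) ∧ s'.reg 4 = n ∧
      ∀ d u, q = d ++ [u] → s'.reg 6 = u.val := by
    rintro s' ⟨done, todo, hlen, h4, hq, hclosed, -, h6⟩
    have hle := hq.length_le
    rw [List.length_append] at hle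
    obtain rfl : todo = [] := List.eq_nil_of_length_eq_zero (by omega)
    rw [List.append_nil] at hq hclosed
    exact ⟨done, hq, hlen, hc.mem_of_closed hq.source hclosed, h4, h6⟩
  unfold bfs
  refine Total.of_le (T := 1 + (1 + (1 + (1 + (1 + (n * (D * 12 + 12) + 1 + (1 + 1)))))))
    (Total.const (Nat.zero_le _) <| Total.const (by omega) <|
    Total.store (by simp [h3]; omega) <| Total.add (by simp [h2, h3]; omega) <|
    Total.store (by simp [ho1]; omega) <|
    Total.cons (Total.loop (T := D * 12 + 11) (Visited G c base (s.arr 3)) n ?_ ?_ ?_)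
      ?_) (by omega)
  · refine ⟨[], [c], rfl, by simp, ⟨by simp, by simp, by simp, by simp [h2], by simp, ?_, ?_, ?_, ?_⟩,
      by simp, ?_, by simp⟩
    · intro i hi
      simp only [List.nil_append, List.length_singleton, Nat.lt_one_iff] at hi
      simp [h3, hz0, hi]
    · intro v hv
      simp only [List.nil_append, List.mem_singleton] at hv
      simp [h3, h2, hv, ho1]
    · intro v hv
      simp only [List.nil_append, List.mem_singleton] at hv
      have : v.val ≠ c.val := fun e => hv (Fin.ext e)
      simp [h3, h2, this, hzero]
    · intro i hi
      have := hi c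
      simp [h3, h2, this]
    · intro u rest hu x hx
      rw [List.cons_eq_cons] at hu
      simp_all
  · rintro i s' hi hv hf
    refine total_bfsVisit hc hi ?_ hv hW hD hDW
    refine Setup.frame (P := bfsVisit) ⟨?_, ?_, ?_, ?_, ?_⟩ hf (by decide) (by decide) (by decide)
        (by decide) (by decide)
    · simpa using hS.size
    · simpa using hS.one
    · simpa using hS.zero
    · funext i; simp [hS.offsets]
    · funext i; simp [hS.lists]
  · rintro s' hv hf
    obtain ⟨q, hq, hlen, -, h4, -⟩ := hend s' hv
    rw [h4, hq.tail, hlen]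
    exact lt_irrefl _
  · rintro s' hv hf
    obtain ⟨q, hq, hlen, hall, h4, h6⟩ := hend s' hv
    have e0 := hf.reg 0 (by decide)
    simp [hS.size] at e0
    refine Total.add (by rw [hq.offset, e0]; omega) <| Total.nil ⟨?_, ?_, ?_, ?_, ?_, ?_⟩
    · simp [hq.offset, e0]
    · exact fun v => hq.dist v (hall v)
    · exact fun i hi => hq.old i fun v => by omega
    · exact fun i hi => (hq.old i fun v => by omega).trans (hzero i (by omega))
    · obtain ⟨d, u, rfl⟩ : ∃ d u, q = d ++ [u] :=
        ⟨_, _, (List.dropLast_append_getLast (List.ne_nil_of_mem (hall c))).symm⟩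
      refine ⟨u, by simpa using h6 d u rfl, fun v => ?_⟩
      have h7 := hq.sorted
      rw [List.pairwise_append] at h7
      rcases List.mem_append.1 (hall v) with hv | hv
      · exact h7.2.2 v hv u (by simp)
      · rw [List.mem_singleton.1 hv]
    · exact ⟨q, hlen, hall, hq.sorted, hq.queue⟩

end WordRAM

namespace WordRAM

open Cmd

/-- Compare the distances of two vertices in one row of the distance table. -/
def compareRow : Cmd := block [add 10 24 6, load 11 3 10, add 10 24 23, load 12 3 10,
  branch 12 11 (const 26 0) skip, add 24 24 0]

/-- Test whether one representative dominates a vertex. -/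
def compareRep : Cmd := block [load 23 5 22, const 26 1, copy 24 16, loop 24 20 compareRow,
  branch 13 26 (const 25 0) skip, add 22 22 1]

/-- Add the next vertex to the representatives unless one of these dominates it. -/
def collectStep : Cmd := block [sub 14 14 1, load 6 4 14, const 25 1, const 22 0,
  loop 22 21 compareRep, branch 13 25 (block [store 5 21 6, add 21 21 1]) skip]

/-- Collect representatives, from the last vertex of the queue to the first. -/
def collect : Cmd := block [copy 14 0, const 21 0, loop 13 14 collectStep]

variable {n : ℕ} {G : SimpleGraph (Fin n)}

/-- The rows of the distance table for the vertices in `B` start at cell `o` of array `3`. -/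
structure Rows (G : SimpleGraph (Fin n)) (o : ℕ) (B : List (Fin n)) (s : State) : Prop where
  size : s.reg 0 = n
  one : s.reg 1 = 1
  zero : s.reg 13 = 0
  start : s.reg 16 = o
  finish : s.reg 20 = o + n * B.length
  dist : ∀ k (h : k < B.length) (v : Fin n), s.arr 3 (o + n * k + v) = G.dist B[k] v + 1

/-- The representatives `R` are stored in array `5`. -/
structure Reps (R : List (Fin n)) (s : State) : Prop where
  count : s.reg 21 = R.length
  cell : ∀ j (h : j < R.length), s.arr 5 j = R[j].val

/-- The vertex `r` is at least as far away as `u` from all vertices in `B`. -/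
def Dominates (G : SimpleGraph (Fin n)) (B : List (Fin n)) (r u : Fin n) : Prop :=
  ∀ b ∈ B, G.dist b u ≤ G.dist b r

theorem Rows.congr {o : ℕ} {B : List (Fin n)} {s s' : State} (h : Rows G o B s)
    (h0 : s'.reg 0 = s.reg 0) (h1 : s'.reg 1 = s.reg 1) (h13 : s'.reg 13 = s.reg 13)
    (h16 : s'.reg 16 = s.reg 16) (h20 : s'.reg 20 = s.reg 20) (h3 : s'.arr 3 = s.arr 3) :
    Rows G o B s' :=
  ⟨h0.trans h.size, h1.trans h.one, h13.trans h.zero, h16.trans h.start, h20.trans h.finish,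
    h3 ▸ h.dist⟩

theorem Rows.frame {o : ℕ} {B : List (Fin n)} {P : Cmd} {s s' : State} (hf : Frame P s s')
    (h : Rows G o B s) (h0 : 0 ∉ P.regs) (h1 : 1 ∉ P.regs) (h13 : 13 ∉ P.regs) (h16 : 16 ∉ P.regs)
    (h20 : 20 ∉ P.regs) (hA : 3 ∉ P.arrs) : Rows G o B s' :=
  h.congr (hf.reg 0 h0) (hf.reg 1 h1) (hf.reg 13 h13) (hf.reg 16 h16) (hf.reg 20 h20) (hf.arr 3 hA)

theorem Reps.congr {R : List (Fin n)} {s s' : State} (h : Reps R s) (h21 : s'.reg 21 = s.reg 21)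
    (h5 : s'.arr 5 = s.arr 5) : Reps R s' :=
  ⟨h21.trans h.count, h5 ▸ h.cell⟩

theorem Reps.frame {R : List (Fin n)} {P : Cmd} {s s' : State} (hf : Frame P s s') (h : Reps R s)
    (h21 : 21 ∉ P.regs) (hA : 5 ∉ P.arrs) : Reps R s' :=
  h.congr (hf.reg 21 h21) (hf.arr 5 hA)

variable {W o : ℕ} {B R : List (Fin n)} {s : State} {u r c : Fin n}

theorem row_end_le {o k : ℕ} (hk : k < B.length) : o + n * k + n ≤ o + n * B.length := by
  have := Nat.mul_le_mul_left n (Nat.succ_le_of_lt hk)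
  rw [Nat.mul_succ] at this
  omega

theorem forall_mem_take_succ {α : Type*} {l : List α} {k : ℕ} (hk : k < l.length) {p : α → Prop} :
    (∀ x ∈ l.take (k + 1), p x) ↔ (∀ x ∈ l.take k, p x) ∧ p l[k] := by
  rw [List.take_add_one, List.getElem?_eq_getElem hk]
  simp only [List.mem_append, Option.toList_some, List.mem_singleton, or_imp, forall_and,
    forall_eq]

theorem total_compareRow (hc : G.Connected) {k : ℕ} (hk : k < B.length) (hr : Rows G o B s)
    (h6 : s.reg 6 = u) (h23 : s.reg 23 = r) (h24 : s.reg 24 = o + n * k) (h26 : s.reg 26 ≤ 1)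
    (hd : 0 < s.reg 26 ↔ ∀ b ∈ B.take k, G.dist b u ≤ G.dist b r)
    (hW : o + n * B.length + n + 1 ≤ W) :
    Total W compareRow 9 s fun s' => s'.reg 24 = o + n * (k + 1) ∧ s'.reg 26 ≤ 1 ∧
      (0 < s'.reg 26 ↔ ∀ b ∈ B.take (k + 1), G.dist b u ≤ G.dist b r) := by
  have h1 := hr.dist k hk u
  have h2 := hr.dist k hk r
  have h3 : G.dist B[k] u + 1 ≤ n := by simpa using hc.dist_lt_card B[k] u
  have h4 : G.dist B[k] r + 1 ≤ n := by simpa using hc.dist_lt_card B[k] r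
  have h5 := row_end_le (n := n) (o := o) hk
  have hun := u.isLt
  have hrn := r.isLt
  rw [forall_mem_take_succ hk]
  unfold compareRow
  refine Total.of_le (T := 1 + (1 + (1 + (1 + ((1 + 1 + 1) + (1 + 1))))))
    (Total.add (by simp [h24, h6]; omega) <|
    Total.load (by simp [h24, h6, h1]; omega) <| Total.add (by simp [h24, h23]; omega) <|
    Total.load (by simp [h24, h23, h2]; omega) <|
    Total.cons (R := fun s' => s'.reg 26 ≤ 1 ∧ (0 < s'.reg 26 ↔
      (∀ b ∈ B.take k, G.dist b u ≤ G.dist b r) ∧ G.dist B[k] u ≤ G.dist B[k] r))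
      (Total.branch ?_ ?_) ?_) le_rfl
  · intro h
    simp [h24, h6, h23, h1, h2] at h
    refine ⟨1, _, .const _ _ _ (Nat.zero_le _), le_rfl, by simp, ?_⟩
    simp only [State.setReg_reg, if_true, lt_irrefl, false_iff]
    exact fun h' => absurd h'.2 (by omega)
  · intro h
    simp [h24, h6, h23, h1, h2] at h
    refine ⟨1, _, .skip _, le_rfl, by simpa using h26, ?_⟩
    simp only [State.setReg_reg]
    simp only [show ((26 : ℕ) = 12) = False by simp, show ((26 : ℕ) = 11) = False by simp,
      show ((26 : ℕ) = 10) = False by simp, if_false]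
    rw [hd]
    exact ⟨fun h' => ⟨h', h⟩, fun h' => h'.1⟩
  · rintro s' ⟨h26', hd'⟩ hf
    have e24 := hf.reg 24 (by decide)
    have e0 := hf.reg 0 (by decide)
    simp [h24, hr.size] at e24 e0
    refine Total.add (by rw [e24, e0]; omega) <| Total.nil ⟨?_, by simpa using h26', by simpa using hd'⟩
    simp [e24, e0, Nat.mul_succ, Nat.add_assoc]

theorem total_compareRep (hc : G.Connected) {j : ℕ} (hj : j < R.length) (hr : Rows G o B s)
    (hR : Reps R s) (h6 : s.reg 6 = u) (h22 : s.reg 22 = j) (h25 : s.reg 25 ≤ 1)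
    (hd : 0 < s.reg 25 ↔ ∀ r ∈ R.take j, ¬ Dominates G B r u)
    (hW : o + n * B.length + n + 1 ≤ W) (hjW : j + 1 ≤ W) :
    Total W compareRep (B.length * 10 + 9) s fun s' => s'.reg 22 = j + 1 ∧ s'.reg 25 ≤ 1 ∧
      (0 < s'.reg 25 ↔ ∀ r ∈ R.take (j + 1), ¬ Dominates G B r u) := by
  have hun := u.isLt
  have hrn := R[j].isLt
  have hcell := hR.cell j hj
  rw [forall_mem_take_succ hj]
  unfold compareRep
  refine Total.of_le (T := 1 + (1 + (1 + ((B.length * (9 + 1) + 1) + ((1 + 1 + 1) + (1 + 1))))))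
    (Total.load (by simp [h22, hcell]; omega) <| Total.const (by omega) <|
    Total.copy (by simp [hr.start]; omega) <|
    Total.cons (Total.loop (T := 9) (fun k s' => s'.reg 24 = o + n * k ∧ s'.reg 26 ≤ 1 ∧
      (0 < s'.reg 26 ↔ ∀ b ∈ B.take k, G.dist b u ≤ G.dist b R[j])) B.length ?_ ?_ ?_) ?_)
      (by omega)
  · refine ⟨?_, ?_, ?_⟩ <;> simp [hr.start]
  · rintro k s' hk ⟨h24, h26, hd'⟩ hf
    have e6 := hf.reg 6 (by decide)
    have e23 := hf.reg 23 (by decide)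
    simp [h6, h22, hcell] at e6 e23
    have hr' : Rows G o B s' := Rows.frame hf
      (hr.congr (by simp) (by simp) (by simp) (by simp) (by simp) rfl)
      (by decide) (by decide) (by decide) (by decide) (by decide) (by decide)
    have := row_end_le (n := n) (o := o) hk
    exact ⟨by rw [h24, hr'.finish]; omega, total_compareRow hc hk hr' e6 e23 h24 h26 hd' hW⟩
  · rintro s' ⟨h24, -⟩ hf
    have e20 := hf.reg 20 (by decide)
    simp [hr.finish] at e20
    omega
  · rintro s' ⟨-, h26, hd'⟩ hf
    rw [List.take_length] at hd'
    have e25 := hf.reg 25 (by decide)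
    have e22 := hf.reg 22 (by decide)
    have e1 := hf.reg 1 (by decide)
    have e13 := hf.reg 13 (by decide)
    simp [h22, hr.one, hr.zero] at e25 e22 e1 e13
    refine Total.cons (R := fun s' => s'.reg 25 ≤ 1 ∧ (0 < s'.reg 25 ↔
      (∀ r ∈ R.take j, ¬ Dominates G B r u) ∧ ¬ Dominates G B R[j] u))
      (Total.branch ?_ ?_) ?_
    · intro h
      rw [e13, hd'] at h
      refine ⟨1, _, .const _ _ _ (Nat.zero_le _), le_rfl, by simp, ?_⟩
      simp only [State.setReg_reg, if_true, lt_irrefl, false_iff]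
      exact fun h' => h'.2 h
    · intro h
      rw [e13, hd'] at h
      refine ⟨1, _, .skip _, le_rfl, by omega, ?_⟩
      rw [e25, hd]
      exact ⟨fun h' => ⟨h', h⟩, fun h' => h'.1⟩
    · rintro s'' ⟨h25', hd''⟩ hf'
      have e22' := hf'.reg 22 (by decide)
      have e1' := hf'.reg 1 (by decide)
      refine Total.add (by rw [e22', e1', e22, e1]; exact hjW) <|
        Total.nil ⟨?_, by simpa using h25', by simpa using hd''⟩
      simp [e22', e1', e22, e1]

/-- Lists of vertices which are ordered by decreasing distance to `c`, and whose members do not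
dominate later ones, are short. -/
theorem length_le_of_pairwise_not_dominates (hc : G.Connected) {K : ℕ}
    (hB : ∀ b ∈ B, G.dist c b ≤ K)
    (hR : R.Pairwise fun x y => G.dist c y ≤ G.dist c x ∧ ¬ Dominates G B x y) :
    R.length ≤ (2 * K + 1) ^ B.length := by
  have hshape : ∀ (b x : Fin n), b ∈ B → G.dist c x ≤ G.dist b x + K ∧
      G.dist b x ≤ G.dist c x + K := by
    intro b x hb
    have h1 := hB b hb
    have h2 := hc.dist_triangle (u := c) (v := b) (w := x)
    have h3 := hc.dist_triangle (u := b) (v := c) (w := x)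
    have h4 := G.dist_comm (u := b) (v := c)
    omega
  let shape : Fin n → Fin B.length → Fin (2 * K + 1) := fun x i =>
    ⟨G.dist B[i] x + K - G.dist c x, by have := hshape B[i] x (List.getElem_mem _); omega⟩
  have hnd : (R.map shape).Nodup := by
    rw [List.Nodup, List.pairwise_map]
    refine hR.imp ?_
    rintro x y ⟨hxy, hdom⟩ heq
    refine hdom fun b hb => ?_
    obtain ⟨i, hi, rfl⟩ := List.mem_iff_getElem.1 hb
    have := congrArg Fin.val (congrFun heq ⟨i, hi⟩)
    have h1 := hshape B[i] x hb
    have h2 := hshape B[i] y hb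
    simp only [shape, Fin.getElem_fin] at this
    omega
  simpa using hnd.length_le_card

/-- The memory while representatives of the vertices in the list `p` are collected. -/
structure Collected (G : SimpleGraph (Fin n)) (c : Fin n) (B p R : List (Fin n)) (s : State) :
    Prop where
  reps : Reps R s
  subset : ∀ r ∈ R, r ∈ p
  cover : ∀ u ∈ p, ∃ r ∈ R, Dominates G B r u
  pairwise : R.Pairwise fun x y => G.dist c y ≤ G.dist c x ∧ ¬ Dominates G B x y

theorem Collected.nodup {p : List (Fin n)} (h : Collected G c B p R s) : R.Nodup :=
  h.pairwise.imp (S := (· ≠ ·)) fun h e => h.2 (e ▸ fun _ _ => le_rfl)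

theorem total_collectStep (hc : G.Connected) {p : List (Fin n)} {i K : ℕ}
    (hp : p.Pairwise fun x y => G.dist c y ≤ G.dist c x) (hi : i < p.length)
    (hB : ∀ b ∈ B, G.dist c b ≤ K) (hr : Rows G o B s) (hC : Collected G c B (p.take i) R s)
    (h14 : s.reg 14 = n - i) (h4 : s.arr 4 (n - i - 1) = p[i])
    (hW : o + n * B.length + n + 1 ≤ W) :
    Total W collectStep ((2 * K + 1) ^ B.length * (B.length * 10 + 10) + 12) s fun s' =>
      s'.reg 14 = n - (i + 1) ∧ ∃ R' : List (Fin n), Collected G c B (p.take (i + 1)) R' s' := by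
  have hlen := length_le_of_pairwise_not_dominates hc hB hC.pairwise
  have hRn : R.length ≤ n := by simpa using hC.nodup.length_le_card
  have hun := p[i].isLt
  unfold collectStep
  refine Total.of_le (T := 1 + (1 + (1 + (1 + ((R.length * (B.length * 10 + 10) + 1) +
    (((1 + (1 + 1)) + 1 + 1) + 1))))))
    (Total.sub (by simp [h14]; omega) <| Total.load (by simp [h14, hr.one, h4]; omega) <|
    Total.const (by omega) <| Total.const (by omega) <|
    Total.cons (Total.loop (T := B.length * 10 + 9) (fun j s' => s'.reg 22 = j ∧ s'.reg 25 ≤ 1 ∧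
      (0 < s'.reg 25 ↔ ∀ r ∈ R.take j, ¬ Dominates G B r p[i])) R.length ?_ ?_ ?_) ?_) ?_
  · refine ⟨?_, ?_, ?_⟩ <;> simp
  · rintro j s' hj ⟨h22, h25, hd⟩ hf
    have e6 := hf.reg 6 (by decide)
    simp [h14, hr.one, h4] at e6
    have hr' : Rows G o B s' := Rows.frame hf
      (hr.congr (by simp) (by simp) (by simp) (by simp) (by simp) rfl)
      (by decide) (by decide) (by decide) (by decide) (by decide) (by decide)
    have hR' : Reps R s' := Reps.frame hf (hC.reps.congr (by simp) rfl)
      (by decide) (by decide)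
    exact ⟨by rw [h22, hR'.count]; exact hj,
      total_compareRep hc hj hr' hR' e6 h22 h25 hd hW (by omega)⟩
  · rintro s' ⟨h22, -⟩ hf
    have e21 := hf.reg 21 (by decide)
    simp [hC.reps.count] at e21
    omega
  · rintro s' ⟨h22, h25, hd⟩ hf
    rw [List.take_length] at hd
    have e14 := hf.reg 14 (by decide)
    have e1 := hf.reg 1 (by decide)
    have e6 := hf.reg 6 (by decide)
    have e13 := hf.reg 13 (by decide)
    simp [h14, hr.one, h4, hr.zero] at e14 e1 e6 e13
    have hR' : Reps R s' := Reps.frame hf (hC.reps.congr (by simp) rfl) (by decide) (by decide)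
    have htake : p.take (i + 1) = p.take i ++ [p[i]] := by
      rw [List.take_add_one, List.getElem?_eq_getElem hi]; rfl
    refine Total.cons (R := fun s' => s'.reg 14 = n - (i + 1) ∧
      ∃ R' : List (Fin n), Collected G c B (p.take (i + 1)) R' s')
      (Total.branch (T₁ := 1 + (1 + 1)) (T₂ := 1) ?_ ?_) fun s' h _ => Total.nil h
    · intro h
      rw [e13, hd] at h
      refine Total.store (by rw [e6]; omega) <| Total.add ?_ <| Total.nil ⟨?_, R ++ [p[i]], ⟨?_, ?_⟩, ?_, ?_, ?_⟩
      · simp [hR'.count, e1]; omega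
      · simp [e14]; omega
      · simp [hR'.count, e1]
      · intro j hj
        simp only [State.setReg_arr, State.setArr_arr, if_true, hR'.count, e6]
        split_ifs with e
        · simp [e]
        · simp only [List.length_append, List.length_singleton] at hj
          rw [hR'.cell j (by omega), List.getElem_append_left]
      · intro r hr
        rw [htake]
        rcases List.mem_append.1 hr with hr | hr
        · exact List.mem_append_left _ (hC.subset r hr)
        · exact List.mem_append_right _ hr
      · intro u hu
        rw [htake] at hu
        rcases List.mem_append.1 hu with hu | hu
        · obtain ⟨r, hr, hru⟩ := hC.cover u hu
          exact ⟨r, List.mem_append_left _ hr, hru⟩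
        · rw [List.mem_singleton] at hu
          exact ⟨p[i], by simp, by rw [hu]; exact fun _ _ => le_rfl⟩
      · rw [List.pairwise_append]
        refine ⟨hC.pairwise, List.pairwise_singleton _ _, ?_⟩
        intro x hx y hy
        rw [List.mem_singleton] at hy
        subst hy
        refine ⟨?_, h x hx⟩
        have hxp := hC.subset x hx
        have h1 := hp.sublist (List.take_sublist (i + 1) p)
        rw [htake, List.pairwise_append] at h1
        exact h1.2.2 x hxp _ (by simp)
    · intro h
      rw [e13, hd] at h
      push Not at h
      refine ⟨1, _, .skip _, le_rfl, by omega, R, hR', ?_, ?_, hC.pairwise⟩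
      · intro r hr
        rw [htake]
        exact List.mem_append_left _ (hC.subset r hr)
      · intro u hu
        rw [htake] at hu
        rcases List.mem_append.1 hu with hu | hu
        · exact hC.cover u hu
        · rw [List.mem_singleton] at hu
          exact hu ▸ h
  · have := Nat.mul_le_mul_right (B.length * 10 + 10) hlen
    omega

theorem total_collect (hc : G.Connected) {q : List (Fin n)} {K : ℕ} (hqn : q.length = n)
    (hq : q.Pairwise fun x y => G.dist c x ≤ G.dist c y) (hall : ∀ v, v ∈ q)
    (hB : ∀ b ∈ B, G.dist c b ≤ K) (hr : Rows G o B s)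
    (h4 : ∀ i (h : i < q.length), s.arr 4 i = q[i])
    (hW : o + n * B.length + n + 1 ≤ W) :
    Total W collect (n * ((2 * K + 1) ^ B.length * (B.length * 10 + 10) + 13) + 4) s fun s' =>
      ∃ R : List (Fin n), Reps R s' ∧ R.length ≤ n ∧ R.length ≤ (2 * K + 1) ^ B.length ∧
        ∀ u, ∃ r ∈ R, Dominates G B r u := by
  unfold collect
  refine Total.of_le (T := 1 + (1 + ((n * ((2 * K + 1) ^ B.length * (B.length * 10 + 10) + 13) +
    1) + 1)))
    (Total.copy (by simp [hr.size]; omega) <| Total.const (by omega) <|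
    Total.cons (Total.loop (T := (2 * K + 1) ^ B.length * (B.length * 10 + 10) + 12)
      (fun i s' => s'.reg 14 = n - i ∧
        ∃ R : List (Fin n), Collected G c B (q.reverse.take i) R s') n ?_ ?_ ?_) ?_) ?_
  · refine ⟨by simp [hr.size], [], ⟨by simp, by simp⟩, by simp, by simp, by simp⟩
  · rintro i s' hi ⟨h14, R, hR⟩ hf
    have hr' : Rows G o B s' := Rows.frame hf
      (hr.congr (by simp) (by simp) (by simp) (by simp) (by simp) rfl)
      (by decide) (by decide) (by decide) (by decide) (by decide) (by decide)
    refine ⟨by rw [h14, hr'.zero]; omega, total_collectStep hc (List.pairwise_reverse.2 hq)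
      (by simpa [hqn] using hi) hB hr' hR h14 ?_ hW⟩
    rw [hf.arr 4 (by decide), List.getElem_reverse]
    simp only [State.setReg_arr]
    rw [h4 _ (by omega)]
    congr 2
    omega
  · rintro s' ⟨h14, -⟩ hf
    omega
  · rintro s' ⟨h14, R, hR⟩ hf
    rw [List.take_of_length_le (by simp [hqn])] at hR
    exact Total.nil ⟨R, hR.reps, by simpa using hR.nodup.length_le_card,
      length_le_of_pairwise_not_dominates hc hB hR.pairwise,
      fun u => hR.cover u (List.mem_reverse.2 (hall u))⟩
  · omega

end WordRAM

namespace WordRAM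

open Cmd

/-- Update the smallest sum of two distances with one row of the distance table. -/
def minStep : Cmd := block [add 10 24 14, load 11 3 10, add 10 24 23, load 12 3 10, add 11 11 12,
  branch 11 26 (copy 26 11) skip, add 24 24 0]

/-- Update the largest detour with one representative. -/
def maxStep : Cmd := block [load 23 5 22, add 26 0 0, copy 24 16, loop 24 20 minStep,
  branch 15 26 (copy 15 26) skip, add 22 22 1]

/-- Write the largest detour between one vertex and the representatives to array `2`. -/
def outputStep : Cmd := block [const 15 0, const 22 0, loop 22 21 maxStep, sub 15 15 1, sub 15 15 1,
  store 2 14 15, add 14 14 1]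

/-- Write the largest detours between all vertices and the representatives to array `2`. -/
def output : Cmd := block [const 14 0, loop 14 0 outputStep]

variable {n : ℕ} {G : SimpleGraph (Fin n)} {W o : ℕ} {B R : List (Fin n)} {s : State} {v r : Fin n}

theorem total_minStep (hc : G.Connected) {k : ℕ} (hk : k < B.length) (hr : Rows G o B s)
    (h14 : s.reg 14 = v) (h23 : s.reg 23 = r) (h24 : s.reg 24 = o + n * k)
    (hmin : ∀ b ∈ B.take k, s.reg 26 ≤ G.dist b v + G.dist b r + 2)
    (hex : ∃ b ∈ B, G.dist b v + G.dist b r + 2 ≤ s.reg 26)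
    (hW : o + n * B.length + 2 * n + 2 ≤ W) :
    Total W minStep 10 s fun s' => s'.reg 24 = o + n * (k + 1) ∧
      (∀ b ∈ B.take (k + 1), s'.reg 26 ≤ G.dist b v + G.dist b r + 2) ∧
      ∃ b ∈ B, G.dist b v + G.dist b r + 2 ≤ s'.reg 26 := by
  have h1 := hr.dist k hk v
  have h2 := hr.dist k hk r
  have h3 : G.dist B[k] v + 1 ≤ n := by simpa using hc.dist_lt_card B[k] v
  have h4 : G.dist B[k] r + 1 ≤ n := by simpa using hc.dist_lt_card B[k] r
  have h5 := row_end_le (n := n) (o := o) hk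
  have hvn := v.isLt
  have hrn := r.isLt
  rw [show (fun s' : State => s'.reg 24 = o + n * (k + 1) ∧
      (∀ b ∈ B.take (k + 1), s'.reg 26 ≤ G.dist b v + G.dist b r + 2) ∧
      ∃ b ∈ B, G.dist b v + G.dist b r + 2 ≤ s'.reg 26) = fun s' => s'.reg 24 = o + n * (k + 1) ∧
      ((∀ b ∈ B.take k, s'.reg 26 ≤ G.dist b v + G.dist b r + 2) ∧
      s'.reg 26 ≤ G.dist B[k] v + G.dist B[k] r + 2) ∧
      ∃ b ∈ B, G.dist b v + G.dist b r + 2 ≤ s'.reg 26 from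
    funext fun s' => by rw [forall_mem_take_succ hk]]
  unfold minStep
  refine Total.of_le (T := 1 + (1 + (1 + (1 + (1 + ((1 + 1 + 1) + (1 + 1)))))))
    (Total.add (by simp [h24, h14]; omega) <|
    Total.load (by simp [h24, h14, h1]; omega) <| Total.add (by simp [h24, h23]; omega) <|
    Total.load (by simp [h24, h23, h2]; omega) <|
    Total.add (by simp [h24, h14, h23, h1, h2]; omega) <|
    Total.cons (R := fun s' =>
      ((∀ b ∈ B.take k, s'.reg 26 ≤ G.dist b v + G.dist b r + 2) ∧
      s'.reg 26 ≤ G.dist B[k] v + G.dist B[k] r + 2) ∧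
      ∃ b ∈ B, G.dist b v + G.dist b r + 2 ≤ s'.reg 26)
      (Total.branch (T₁ := 1) (T₂ := 1) ?_ ?_) ?_) le_rfl
  · intro h
    simp [h24, h14, h23, h1, h2] at h
    refine ⟨1, _, .copy _ _ _ ?_, le_rfl, ⟨?_, ?_⟩, B[k], List.getElem_mem _, ?_⟩
    · simp [h24, h14, h23, h1, h2]; omega
    · intro b hb
      have := hmin b hb
      simp [h24, h14, h23, h1, h2]; omega
    · simp [h24, h14, h23, h1, h2]; omega
    · simp [h24, h14, h23, h1, h2]; omega
  · intro h
    simp [h24, h14, h23, h1, h2] at h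
    exact ⟨1, _, .skip _, le_rfl, ⟨by simpa using hmin, by simp; omega⟩, by simpa using hex⟩
  · rintro s' ⟨hmin', hex'⟩ hf
    have e24 := hf.reg 24 (by decide)
    have e0 := hf.reg 0 (by decide)
    simp [h24, hr.size] at e24 e0
    refine Total.add (by rw [e24, e0]; omega) <| Total.nil ⟨?_, by simpa using hmin', by simpa using hex'⟩
    simp [e24, e0, Nat.mul_succ, Nat.add_assoc]

theorem total_maxStep (hc : G.Connected) {j : ℕ} (hj : j < R.length) (hr : Rows G o B s)
    (hR : Reps R s) (h14 : s.reg 14 = v) (h22 : s.reg 22 = j) (h15 : s.reg 15 ≤ W)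
    (hmax : ∀ r ∈ R.take j, ∃ b ∈ B, G.dist b v + G.dist b r + 2 ≤ s.reg 15)
    (hex : s.reg 15 = 0 ∨ ∃ r ∈ R, ∀ b ∈ B, s.reg 15 ≤ G.dist b v + G.dist b r + 2)
    (hW : o + n * B.length + 2 * n + 2 ≤ W) (hjW : j + 1 ≤ W) (hB : B ≠ []) :
    Total W maxStep (B.length * 11 + 9) s fun s' => s'.reg 22 = j + 1 ∧ s'.reg 15 ≤ W ∧
      (∀ r ∈ R.take (j + 1), ∃ b ∈ B, G.dist b v + G.dist b r + 2 ≤ s'.reg 15) ∧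
      (s'.reg 15 = 0 ∨ ∃ r ∈ R, ∀ b ∈ B, s'.reg 15 ≤ G.dist b v + G.dist b r + 2) := by
  have hvn := v.isLt
  have hrn := R[j].isLt
  have hcell := hR.cell j hj
  rw [show (fun s' : State => s'.reg 22 = j + 1 ∧ s'.reg 15 ≤ W ∧
      (∀ r ∈ R.take (j + 1), ∃ b ∈ B, G.dist b v + G.dist b r + 2 ≤ s'.reg 15) ∧
      (s'.reg 15 = 0 ∨ ∃ r ∈ R, ∀ b ∈ B, s'.reg 15 ≤ G.dist b v + G.dist b r + 2)) = fun s' =>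
      s'.reg 22 = j + 1 ∧ s'.reg 15 ≤ W ∧
      ((∀ r ∈ R.take j, ∃ b ∈ B, G.dist b v + G.dist b r + 2 ≤ s'.reg 15) ∧
        ∃ b ∈ B, G.dist b v + G.dist b R[j] + 2 ≤ s'.reg 15) ∧
      (s'.reg 15 = 0 ∨ ∃ r ∈ R, ∀ b ∈ B, s'.reg 15 ≤ G.dist b v + G.dist b r + 2) from
    funext fun s' => by rw [forall_mem_take_succ hj]]
  unfold maxStep
  refine Total.of_le (T := 1 + (1 + (1 + ((B.length * (10 + 1) + 1) + ((1 + 1 + 1) + (1 + 1))))))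
    (Total.load (by simp [h22, hcell]; omega) <| Total.add (by simp [hr.size]; omega) <|
    Total.copy (by simp [hr.start]; omega) <|
    Total.cons (Total.loop (T := 10) (fun k s' => s'.reg 24 = o + n * k ∧
      (∀ b ∈ B.take k, s'.reg 26 ≤ G.dist b v + G.dist b R[j] + 2) ∧
      ∃ b ∈ B, G.dist b v + G.dist b R[j] + 2 ≤ s'.reg 26) B.length ?_ ?_ ?_) ?_)
      (by omega)
  · refine ⟨by simp [hr.start], by simp, ?_⟩
    obtain ⟨b, hb⟩ := List.exists_mem_of_ne_nil B hB
    have h3 : G.dist b v + 1 ≤ n := by simpa using hc.dist_lt_card b v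
    have h4 : G.dist b R[j] + 1 ≤ n := by simpa using hc.dist_lt_card b R[j]
    exact ⟨b, hb, by simp [hr.size]; omega⟩
  · rintro k s' hk ⟨h24, hmin, hex'⟩ hf
    have e14 := hf.reg 14 (by decide)
    have e23 := hf.reg 23 (by decide)
    simp [h14, h22, hcell] at e14 e23
    have hr' : Rows G o B s' := Rows.frame hf
      (hr.congr (by simp) (by simp) (by simp) (by simp) (by simp) rfl)
      (by decide) (by decide) (by decide) (by decide) (by decide) (by decide)
    have := row_end_le (n := n) (o := o) hk
    exact ⟨by rw [h24, hr'.finish]; omega, total_minStep hc hk hr' e14 e23 h24 hmin hex' hW⟩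
  · rintro s' ⟨h24, -⟩ hf
    have e20 := hf.reg 20 (by decide)
    simp [hr.finish] at e20
    omega
  · rintro s' ⟨-, hmin, b, hb, hbv⟩ hf
    rw [List.take_length] at hmin
    have e15 := hf.reg 15 (by decide)
    have e22 := hf.reg 22 (by decide)
    have e1 := hf.reg 1 (by decide)
    simp [h22, hr.one] at e15 e22 e1
    refine Total.cons (R := fun s' => s'.reg 15 ≤ W ∧
      ((∀ r ∈ R.take j, ∃ b ∈ B, G.dist b v + G.dist b r + 2 ≤ s'.reg 15) ∧
        ∃ b ∈ B, G.dist b v + G.dist b R[j] + 2 ≤ s'.reg 15) ∧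
      (s'.reg 15 = 0 ∨ ∃ r ∈ R, ∀ b ∈ B, s'.reg 15 ≤ G.dist b v + G.dist b r + 2))
      (Total.branch (T₁ := 1) (T₂ := 1) ?_ ?_) ?_
    · intro h
      have h26 : s'.reg 26 ≤ W := by
        have h3 : G.dist b v + 1 ≤ n := by simpa using hc.dist_lt_card b v
        have h4 : G.dist b R[j] + 1 ≤ n := by simpa using hc.dist_lt_card b R[j]
        have := hmin b hb
        omega
      refine ⟨1, _, .copy _ _ _ h26, le_rfl, by simpa using h26, ⟨?_, b, hb, by simpa using hbv⟩,
        Or.inr ⟨R[j], List.getElem_mem _, by simpa using hmin⟩⟩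
      intro r hr
      obtain ⟨b', hb', hle⟩ := hmax r hr
      exact ⟨b', hb', by simp; omega⟩
    · intro h
      refine ⟨1, _, .skip _, le_rfl, by omega, ⟨?_, b, hb, by omega⟩, ?_⟩
      · rw [e15]; exact hmax
      · rw [e15]; exact hex
    · rintro s'' ⟨h15', hmax', hex'⟩ hf'
      have e22' := hf'.reg 22 (by decide)
      have e1' := hf'.reg 1 (by decide)
      refine Total.add (by rw [e22', e1', e22, e1]; exact hjW) <|
        Total.nil ⟨?_, by simpa using h15', by simpa using hmax', by simpa using hex'⟩
      simp [e22', e1', e22, e1]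

/-- The number `e` is the largest detour over `B` between `v` and a vertex in `R`. -/
def IsMaxDetour (G : SimpleGraph (Fin n)) (B R : List (Fin n)) (v : Fin n) (e : ℕ) : Prop :=
  (∀ r ∈ R, ∃ b ∈ B, G.dist b v + G.dist b r ≤ e) ∧
    ∃ r ∈ R, ∀ b ∈ B, e ≤ G.dist b v + G.dist b r

theorem total_outputStep (hc : G.Connected) (hr : Rows G o B s) (hR : Reps R s)
    (h14 : s.reg 14 = v) (hRn : R.length ≤ n) (hRne : R ≠ [])
    (hW : o + n * B.length + 2 * n + 2 ≤ W) (hB : B ≠ []) :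
    Total W outputStep (R.length * (B.length * 11 + 10) + 8) s fun s' => s'.reg 14 = v + 1 ∧
      IsMaxDetour G B R v (s'.arr 2 v) ∧ ∀ i, i ≠ v.val → s'.arr 2 i = s.arr 2 i := by
  have hvn := v.isLt
  unfold outputStep
  refine Total.of_le (T := 1 + (1 + ((R.length * (B.length * 11 + 10) + 1) +
    (1 + (1 + (1 + (1 + 1)))))))
    (Total.const (by omega) <| Total.const (by omega) <|
    Total.cons (Total.loop (T := B.length * 11 + 9) (fun j s' => s'.reg 22 = j ∧ s'.reg 15 ≤ W ∧
      (∀ r ∈ R.take j, ∃ b ∈ B, G.dist b v + G.dist b r + 2 ≤ s'.reg 15) ∧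
      (s'.reg 15 = 0 ∨ ∃ r ∈ R, ∀ b ∈ B, s'.reg 15 ≤ G.dist b v + G.dist b r + 2))
      R.length ?_ ?_ ?_) ?_) (by omega)
  · exact ⟨by simp, by simp, by simp, Or.inl (by simp)⟩
  · rintro j s' hj ⟨h22, h15, hmax, hex⟩ hf
    have e14 := hf.reg 14 (by decide)
    simp [h14] at e14
    have hr' : Rows G o B s' := Rows.frame hf
      (hr.congr (by simp) (by simp) (by simp) (by simp) (by simp) rfl)
      (by decide) (by decide) (by decide) (by decide) (by decide) (by decide)
    have hR' : Reps R s' := Reps.frame hf (hR.congr (by simp) rfl) (by decide) (by decide)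
    exact ⟨by rw [h22, hR'.count]; exact hj,
      total_maxStep hc hj hr' hR' e14 h22 h15 hmax hex hW (by omega) hB⟩
  · rintro s' ⟨h22, -⟩ hf
    have e21 := hf.reg 21 (by decide)
    simp [hR.count] at e21
    omega
  · rintro s' ⟨-, h15, hmax, hex⟩ hf
    rw [List.take_length] at hmax
    have e14 := hf.reg 14 (by decide)
    have e1 := hf.reg 1 (by decide)
    have e2 := hf.arr 2 (by decide)
    simp [h14, hr.one] at e14 e1 e2
    refine Total.sub (by omega) <| Total.sub (by simp; omega) <|
      Total.store (by simp [e1]; omega) <| Total.add (by simp [e1, e14]; omega) <|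
      Total.nil ⟨by simp [e1, e14], ?_, ?_⟩
    · have hval : ((((s'.setReg 15 (s'.reg 15 - s'.reg 1)).setReg 15
          ((s'.setReg 15 (s'.reg 15 - s'.reg 1)).reg 15 -
          (s'.setReg 15 (s'.reg 15 - s'.reg 1)).reg 1))).reg 15) = s'.reg 15 - 2 := by
        simp [e1]; omega
      simp only [State.setReg_arr, State.setArr_arr, hval]
      simp only [State.setReg_reg, e14]
      simp
      constructor
      · intro r hr
        obtain ⟨b, hb, h⟩ := hmax r hr
        exact ⟨b, hb, by omega⟩
      · rcases hex with hex | ⟨r, hr, h⟩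
        · obtain ⟨r, hr⟩ := List.exists_mem_of_ne_nil R hRne
          obtain ⟨b, hb, h⟩ := hmax r hr
          omega
        · exact ⟨r, hr, fun b hb => by have := h b hb; omega⟩
    · intro i hi
      simp [e14, hi, e2]

theorem total_output (hc : G.Connected) (hr : Rows G o B s) (hR : Reps R s)
    (hRn : R.length ≤ n) (hRne : R ≠ []) (hW : o + n * B.length + 2 * n + 2 ≤ W) (hB : B ≠ []) :
    Total W output (n * (R.length * (B.length * 11 + 10) + 9) + 3) s fun s' =>
      ∀ v : Fin n, IsMaxDetour G B R v (s'.arr 2 v) := by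
  unfold output
  refine Total.of_le (T := 1 + ((n * (R.length * (B.length * 11 + 10) + 9) + 1) + 1))
    (Total.const (by omega) <|
    Total.cons (Total.loop (T := R.length * (B.length * 11 + 10) + 8) (fun i s' => s'.reg 14 = i ∧
      ∀ v : Fin n, v.val < i → IsMaxDetour G B R v (s'.arr 2 v)) n ?_ ?_ ?_) ?_) (by omega)
  · simp
  · rintro i s' hi ⟨h14, hout⟩ hf
    have hr' : Rows G o B s' := Rows.frame hf
      (hr.congr (by simp) (by simp) (by simp) (by simp) (by simp) rfl)
      (by decide) (by decide) (by decide) (by decide) (by decide) (by decide)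
    have hR' : Reps R s' := Reps.frame hf (hR.congr (by simp) rfl) (by decide) (by decide)
    refine ⟨by rw [h14, hr'.size]; exact hi,
      (total_outputStep (v := ⟨i, hi⟩) hc hr' hR' h14 hRn hRne hW hB).mono le_rfl ?_⟩
    rintro s'' ⟨h14', hv, hold⟩ -
    refine ⟨h14', fun v hvi => ?_⟩
    by_cases e : v.val = i
    · obtain rfl : v = ⟨i, hi⟩ := Fin.ext e
      exact hv
    · rw [hold v e]
      exact hout v (by omega)
  · rintro s' ⟨h14, -⟩ hf
    have e0 := hf.reg 0 (by decide)
    simp [hr.size] at e0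
    omega
  · rintro s' ⟨-, hout⟩ -
    exact Total.nil fun v => hout v v.isLt

end WordRAM

namespace WordRAM

open Cmd

/-- Compare one vertex with the best midpoint that was found so far. -/
def centerStep : Cmd := block [add 10 0 14, load 11 3 10, add 10 10 0, load 12 3 10,
  branch 11 12 (copy 11 12) skip, branch 11 15 (block [copy 15 11, copy 3 14]) skip, add 14 14 1]

/-- Find a midpoint between two almost diametral vertices and search from it. -/
def center : Cmd := block [const 1 1, bfs, copy 3 6, bfs, copy 3 6, bfs, const 14 0, add 15 0 1,
  loop 14 0 centerStep, bfs]

/-- Search from one vertex if it is in the ball. -/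
def gatherStep : Cmd := block [add 10 17 14, load 11 3 10, branch 11 19 (block [copy 3 14, bfs]) skip,
  add 14 14 1]

/-- Search from all vertices of the ball of radius `7`, and then once more from its center. -/
def gather : Cmd := block [copy 16 2, sub 17 2 0, copy 18 3, const 19 9, const 14 0,
  loop 14 0 gatherStep, copy 20 2, copy 3 18, bfs]

/-- The program which computes all eccentricities. -/
def eccentricities : Cmd := block [center, gather, collect, output]

variable {n : ℕ} {G : SimpleGraph (Fin n)} {L : AdjLists G} {W D : ℕ} {s : State} {l : List (Fin n)}
  {c : Fin n}

/-- Array `3` is the table of the distances from the vertices in `l`. -/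
structure Table (L : AdjLists G) (l : List (Fin n)) (s : State) : Prop where
  setup : Setup L s
  next : s.reg 2 = n * l.length
  dist : ∀ k (h : k < l.length) (v : Fin n), s.arr 3 (n * k + v) = G.dist l[k] v + 1
  free : ∀ i, n * l.length ≤ i → s.arr 3 i = 0

theorem Table.frame {P : Cmd} {s' : State} (hf : Frame P s s') (h : Table L l s) (h0 : 0 ∉ P.regs)
    (h1 : 1 ∉ P.regs) (h13 : 13 ∉ P.regs) (h2 : 2 ∉ P.regs) (hA : 0 ∉ P.arrs) (hB : 1 ∉ P.arrs)
    (hC : 3 ∉ P.arrs) : Table L l s' :=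
  ⟨h.setup.frame hf h0 h1 h13 hA hB, (hf.reg 2 h2).trans h.next, (hf.arr 3 hC) ▸ h.dist,
    (hf.arr 3 hC) ▸ h.free⟩

theorem Table.setReg {r k : ℕ} (h : Table L l s) (h0 : r ≠ 0) (h1 : r ≠ 1) (h13 : r ≠ 13)
    (h2 : r ≠ 2) : Table L l (s.setReg r k) :=
  ⟨⟨by simp [h0.symm, h.setup.size], by simp [h1.symm, h.setup.one],
    by simp [h13.symm, h.setup.zero], h.setup.offsets, h.setup.lists⟩,
    by simp [h2.symm, h.next], h.dist, h.free⟩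

theorem total_bfs_table (hc : G.Connected) (hT : Table L l s) (h3 : s.reg 3 = c)
    (hW : n * (l.length + 1) + 2 ≤ W) (hD : ∀ v, (L.nbrs v).length ≤ D) (hDW : n * D + 1 ≤ W) :
    Total W bfs (n * (D * 12 + 12) + 8) s fun s' => Table L (l ++ [c]) s' ∧
      (∃ u : Fin n, s'.reg 6 = u ∧ ∀ v, G.dist c v ≤ G.dist c u) ∧
      ∃ q : List (Fin n), q.length = n ∧ (∀ v, v ∈ q) ∧
        q.Pairwise (fun x y => G.dist c x ≤ G.dist c y) ∧
        ∀ i (h : i < q.length), s'.arr 4 i = q[i] := by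
  rw [Nat.mul_succ] at hW
  refine (total_bfs hc hT.setup h3 hT.next hT.free (by omega) hD hDW).mono le_rfl ?_
  rintro s' ⟨h2, hnew, hold, hfree, hfar, hq⟩ hf
  refine ⟨⟨hT.setup.frame hf (by decide) (by decide) (by decide) (by decide) (by decide),
    by simp [h2, Nat.mul_succ], ?_, ?_⟩, hfar, hq⟩
  · intro k hk v
    simp only [List.length_append, List.length_singleton] at hk
    rcases Nat.lt_or_ge k l.length with h | h
    · have := row_end_le (n := n) (o := 0) h
      have := v.isLt
      rw [hold _ (by omega), hT.dist k h v, List.getElem_append_left]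
    · obtain rfl : k = l.length := by omega
      rw [hnew v]
      simp
  · intro i hi
    simp only [List.length_append, List.length_singleton, Nat.mul_succ] at hi
    exact hfree i hi

theorem total_centerStep (hc : G.Connected) {a x y : Fin n} {i : ℕ} (hi : i < n)
    (hT : Table L [a, x, y] s) (h14 : s.reg 14 = i)
    (hle : ∀ v : Fin n, v.val < i → s.reg 15 ≤ max (G.dist x v) (G.dist y v) + 1)
    (hex : s.reg 15 = n + 1 ∨
      ∃ c : Fin n, s.reg 3 = c ∧ s.reg 15 = max (G.dist x c) (G.dist y c) + 1)
    (hW : n * 4 + 2 ≤ W) :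
    Total W centerStep 14 s fun s' => s'.reg 14 = i + 1 ∧
      (∀ v : Fin n, v.val < i + 1 → s'.reg 15 ≤ max (G.dist x v) (G.dist y v) + 1) ∧
      (s'.reg 15 = n + 1 ∨
        ∃ c : Fin n, s'.reg 3 = c ∧ s'.reg 15 = max (G.dist x c) (G.dist y c) + 1) := by
  obtain ⟨z, rfl⟩ : ∃ z : Fin n, z.val = i := ⟨⟨i, hi⟩, rfl⟩
  have h1 := hT.dist 1 (by simp) z
  have h2 := hT.dist 2 (by simp) z
  simp only [List.getElem_cons_succ, List.getElem_cons_zero, Nat.mul_one] at h1 h2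
  have h2' : s.arr 3 (n + z + n) = G.dist y z + 1 := by rw [← h2]; congr 1; omega
  have h3 : G.dist x z + 1 ≤ n := by simpa using hc.dist_lt_card x z
  have h4 : G.dist y z + 1 ≤ n := by simpa using hc.dist_lt_card y z
  have h0 := hT.setup.size
  have ho := hT.setup.one
  unfold centerStep
  refine Total.of_le (T := 1 + (1 + (1 + (1 + ((1 + 1 + 1) + (((1 + (1 + 1)) + 1 + 1) + (1 + 1)))))))
    (Total.add (by simp [h0, h14]; omega) <|
    Total.load (by simp [h0, h14, h1]; omega) <|
    Total.add (by simp [h0, h14]; omega) <|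
    Total.load (by simp [h0, h14, h2']; omega) <|
    Total.cons (R := fun s' => s'.reg 11 = max (G.dist x z) (G.dist y z) + 1)
      (Total.branch (T₁ := 1) (T₂ := 1) ?_ ?_) ?_) le_rfl
  · intro h
    simp [h0, h14, h1, h2'] at h
    refine ⟨1, _, .copy _ _ _ ?_, le_rfl, ?_⟩
    · simp [h0, h14, h2']; omega
    · simp [h0, h14, h2']; omega
  · intro h
    simp [h0, h14, h1, h2'] at h
    refine ⟨1, _, .skip _, le_rfl, ?_⟩
    simp [h0, h14, h1]; omega
  · intro s' h11 hf
    have e14 := hf.reg 14 (by decide)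
    have e15 := hf.reg 15 (by decide)
    have e3 := hf.reg 3 (by decide)
    have e1 := hf.reg 1 (by decide)
    simp [h14, ho] at e14 e15 e3 e1
    refine Total.cons (R := fun s' => s'.reg 14 = z ∧ s'.reg 1 = 1 ∧
      (∀ v : Fin n, v.val < z + 1 → s'.reg 15 ≤ max (G.dist x v) (G.dist y v) + 1) ∧
      (s'.reg 15 = n + 1 ∨
        ∃ c : Fin n, s'.reg 3 = c ∧ s'.reg 15 = max (G.dist x c) (G.dist y c) + 1))
      (Total.branch (T₁ := 1 + (1 + 1)) (T₂ := 1) ?_ ?_) ?_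
    · intro h
      rw [h11, e15] at h
      refine Total.copy (by rw [h11]; omega) <| Total.copy (by simp [e14]; omega) <|
        Total.nil ⟨by simpa using e14, by simpa using e1, ?_, Or.inr ⟨z, by simpa using e14, by simpa using h11⟩⟩
      intro v hv
      simp only [State.setReg_reg, h11]
      simp only [show ((15 : ℕ) = 3) = False by simp, if_false, if_true]
      rcases Nat.lt_or_ge v z with hvz | hvz
      · have := hle v hvz
        omega
      · obtain rfl : v = z := Fin.ext (by omega)
        exact le_rfl
    · intro h
      rw [h11, e15] at h
      refine ⟨1, _, .skip _, le_rfl, e14, e1, ?_, by rwa [e15, e3]⟩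
      intro v hv
      rw [e15]
      rcases Nat.lt_or_ge v z with hvz | hvz
      · exact hle v hvz
      · obtain rfl : v = z := Fin.ext (by omega)
        omega
    · rintro s'' ⟨e14', e1', hle', hex'⟩ -
      refine Total.add (by rw [e14', e1']; omega) <| Total.nil ⟨?_, by simpa using hle', by simpa using hex'⟩
      simp [e14', e1']

/-- The vertex `c` is a midpoint of almost diametral vertices. -/
def IsMidpoint (G : SimpleGraph (Fin n)) (a x y c : Fin n) : Prop :=
  (∀ v, G.dist a v ≤ G.dist a x) ∧ (∀ v, G.dist x v ≤ G.dist x y) ∧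
    ∀ v, max (G.dist x c) (G.dist y c) ≤ max (G.dist x v) (G.dist y v)

theorem inputState_table : Table L [] (L.inputState.setReg 1 1) := by
  refine ⟨⟨?_, by simp, ?_, rfl, rfl⟩, ?_, by simp, ?_⟩
  · simp [AdjLists.inputState]
  · simp [AdjLists.inputState]
  · simp [AdjLists.inputState]
  · intro i _
    simp [AdjLists.inputState]

theorem total_center (hc : G.Connected) (hn : 0 < n) (hW : n * 4 + 2 ≤ W)
    (hD : ∀ v, (L.nbrs v).length ≤ D) (hDW : n * D + 1 ≤ W) :
    Total W center (4 * (n * (D * 12 + 12) + 8) + n * 15 + 7) L.inputState fun s' =>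
      ∃ a x y c : Fin n, IsMidpoint G a x y c ∧ Table L [a, x, y, c] s' ∧ s'.reg 3 = c := by
  have hT0 := inputState_table (L := L)
  have h30 : (L.inputState.setReg 1 1).reg 3 = (⟨0, hn⟩ : Fin n) := by
    simp [AdjLists.inputState]
  set a : Fin n := ⟨0, hn⟩
  unfold center
  refine Total.of_le (T := 1 + ((n * (D * 12 + 12) + 8) + (1 + ((n * (D * 12 + 12) + 8) + (1 +
    ((n * (D * 12 + 12) + 8) + (1 + (1 + ((n * (14 + 1) + 1) + ((n * (D * 12 + 12) + 8) + 1))))))))))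
    (Total.const (by omega) <| Total.cons (total_bfs_table hc hT0 h30 (by simp; omega) hD hDW) ?_)
    (by omega)
  rintro s₁ ⟨hT1, ⟨x, h6, hx⟩, -⟩ -
  have hxn := x.isLt
  refine Total.copy (by omega) <| Total.cons (total_bfs_table (c := x) hc
    (hT1.setReg (by decide) (by decide) (by decide) (by decide)) (by simpa using h6)
    (by simp; omega) hD hDW) ?_
  rintro s₂ ⟨hT2, ⟨y, h6', hy⟩, -⟩ -
  have hyn := y.isLt
  refine Total.copy (by omega) <| Total.cons (total_bfs_table (c := y) hc
    (hT2.setReg (by decide) (by decide) (by decide) (by decide)) (by simpa using h6')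
    (by simp; omega) hD hDW) ?_
  rintro s₃ ⟨hT3, -, -⟩ -
  have h0 := hT3.setup.size
  have ho := hT3.setup.one
  refine Total.const (Nat.zero_le _) <| Total.add (by simp [h0, ho]; omega) <|
    Total.cons (Total.loop (T := 14) (fun i s' => s'.reg 14 = i ∧
      (∀ v : Fin n, v.val < i → s'.reg 15 ≤ max (G.dist x v) (G.dist y v) + 1) ∧
      (s'.reg 15 = n + 1 ∨
        ∃ c : Fin n, s'.reg 3 = c ∧ s'.reg 15 = max (G.dist x c) (G.dist y c) + 1)) n ?_ ?_ ?_) ?_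
  · exact ⟨by simp, by simp, Or.inl (by simp [h0, ho])⟩
  · rintro i s' hi ⟨h14, hle, hex⟩ hf
    have hT' : Table L [a, x, y] s' := Table.frame hf
      ((hT3.setReg (by decide) (by decide) (by decide) (by decide)).setReg
        (by decide) (by decide) (by decide) (by decide))
      (by decide) (by decide) (by decide) (by decide) (by decide) (by decide) (by decide)
    exact ⟨by rw [h14, hT'.setup.size]; exact hi, total_centerStep hc hi hT' h14 hle hex hW⟩
  · rintro s' ⟨h14, -⟩ hf
    have e0 := hf.reg 0 (by decide)
    simp [h0] at e0
    omega
  · rintro s' ⟨-, hle, hex⟩ hf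
    have hT' : Table L [a, x, y] s' := Table.frame hf
      ((hT3.setReg (by decide) (by decide) (by decide) (by decide)).setReg
        (by decide) (by decide) (by decide) (by decide))
      (by decide) (by decide) (by decide) (by decide) (by decide) (by decide) (by decide)
    obtain ⟨c, h3, h15⟩ := hex.resolve_left (by
      have := hle a a.isLt
      have h3 : G.dist x a + 1 ≤ n := by simpa using hc.dist_lt_card x a
      have h4 : G.dist y a + 1 ≤ n := by simpa using hc.dist_lt_card y a
      omega)
    refine Total.cons (total_bfs_table hc hT' h3 (by simp; omega) hD hDW) ?_
    rintro s'' ⟨hT'', -, -⟩ hf'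
    refine Total.nil ⟨a, x, y, c, ⟨hx, hy, fun v => ?_⟩, hT'', (hf'.reg 3 (by decide)).trans h3⟩
    have := hle v v.isLt
    omega

theorem total_gatherStep (hc : G.Connected) {a x y : Fin n} {i M : ℕ} {B : List (Fin n)}
    (hi : i < n) (hT : Table L ([a, x, y, c] ++ B) s) (h14 : s.reg 14 = i) (h17 : s.reg 17 = n * 3)
    (h19 : s.reg 19 = 9) (hB : ∀ b : Fin n, b ∈ B ↔ b.val < i ∧ G.dist c b ≤ 7)
    (hM : B.length ≤ M) (hW : n * (M + 5) + 2 ≤ W)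
    (hD : ∀ v, (L.nbrs v).length ≤ D) (hDW : n * D + 1 ≤ W) :
    ∃ T, Total W gatherStep T s fun s' =>
      (s'.reg 14 = i + 1 ∧ ∃ e : List (Fin n), Table L ([a, x, y, c] ++ (B ++ e)) s' ∧
        (∀ b : Fin n, b ∈ B ++ e ↔ b.val < i + 1 ∧ G.dist c b ≤ 7) ∧
        (e = [] ∨ ∃ z : Fin n, z.val = i ∧ e = [z])) ∧
      T + s.reg 2 * (D * 12 + 20) ≤ 8 + s'.reg 2 * (D * 12 + 20) := by
  obtain ⟨z, rfl⟩ : ∃ z : Fin n, z.val = i := ⟨⟨i, hi⟩, rfl⟩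
  have hd := hT.dist 3 (by simp) z
  simp at hd
  have h1 : G.dist c z + 1 ≤ n := by simpa using hc.dist_lt_card c z
  have ho := hT.setup.one
  have hnM := Nat.mul_le_mul_left n (show B.length + 5 ≤ M + 5 by omega)
  have hn5 := Nat.mul_le_mul_left n (show 5 ≤ M + 5 by omega)
  by_cases h : G.dist c z ≤ 7
  · refine ⟨1 + (1 + ((1 + ((n * (D * 12 + 12) + 8) + 1)) + 1 + (1 + 1))), ?_⟩
    refine Total.add (by simp [h17, h14]; omega) <| Total.load (by simp [h17, h14, hd]; omega) <|
      Total.cons (R := fun s' => Table L ([a, x, y, c] ++ (B ++ [z])) s' ∧ s'.reg 14 = z)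
      (Total.branch_true (by simp [h17, h14, hd, h19]; omega) ?_) ?_
    · refine Total.copy (by simp [h14]; omega) <| Total.cons (total_bfs_table (c := z) hc
        (((hT.setReg (by decide) (by decide) (by decide) (by decide)).setReg
          (by decide) (by decide) (by decide) (by decide)).setReg
          (by decide) (by decide) (by decide) (by decide)) (by simp [h14])
        (by
          simp only [List.length_append, List.length_cons, List.length_nil]
          rw [show 0 + 1 + 1 + 1 + 1 + B.length + 1 = B.length + 5 by omega]
          omega) hD hDW) ?_
      rintro s' ⟨hT', -, -⟩ hf
      refine Total.nil ⟨?_, ?_⟩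
      · rwa [List.append_assoc] at hT'
      · rw [hf.reg 14 (by decide)]
        simp [h14]
    · rintro s' ⟨hT', h14'⟩ hf
      have e1 := hT'.setup.one
      refine Total.add (by rw [h14', e1]; omega) <| Total.nil ⟨⟨by simp [h14', e1], [z],
        hT'.setReg (by decide) (by decide) (by decide) (by decide), ?_, Or.inr ⟨z, rfl, rfl⟩⟩, ?_⟩
      · intro b
        rw [List.mem_append, hB, List.mem_singleton]
        constructor
        · rintro (hb | rfl)
          · exact ⟨by omega, hb.2⟩
          · exact ⟨by omega, h⟩
        · rintro ⟨hb, hb'⟩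
          rcases Nat.lt_or_ge b z with hbz | hbz
          · exact Or.inl ⟨hbz, hb'⟩
          · exact Or.inr (Fin.ext (by omega))
      · have e2 := hT'.next
        have e2' := hT.next
        have : s'.reg 2 = s.reg 2 + n := by
          rw [e2, e2']
          simp only [List.length_append, List.length_cons, List.length_nil]
          ring
        simp only [State.setReg_reg, show ((2 : ℕ) = 14) = False by simp, if_false, this]
        have : n * (D * 12 + 12) + 8 ≤ n * (D * 12 + 20) := by
          nlinarith
        rw [Nat.add_mul]
        omega
  · refine ⟨1 + (1 + (1 + 1 + (1 + 1))), ?_⟩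
    refine Total.add (by simp [h17, h14]; omega) <| Total.load (by simp [h17, h14, hd]; omega) <|
      Total.cons (Total.branch_false (T := 1) (Q := (· = (s.setReg 10 (s.reg 17 + s.reg 14)).setReg 11
        ((s.setReg 10 (s.reg 17 + s.reg 14)).arr 3 ((s.setReg 10 (s.reg 17 + s.reg 14)).reg 10))))
        (by simp [h17, h14, hd, h19]; omega) ⟨1, _, .skip _, le_rfl, rfl⟩) ?_
    rintro s' rfl -
    refine Total.add (by simp [h14, ho]; omega) <| Total.nil ⟨⟨by simp [h14, ho], [], ?_, ?_, Or.inl rfl⟩, ?_⟩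
    · rw [List.append_nil]
      exact ((hT.setReg (by decide) (by decide) (by decide) (by decide)).setReg
          (by decide) (by decide) (by decide) (by decide)).setReg
          (by decide) (by decide) (by decide) (by decide)
    · intro b
      rw [List.append_nil, hB]
      constructor
      · rintro ⟨hb, hb'⟩
        exact ⟨by omega, hb'⟩
      · rintro ⟨hb, hb'⟩
        refine ⟨?_, hb'⟩
        rcases Nat.lt_or_ge b z with hbz | hbz
        · exact hbz
        · exact absurd hb' (by rwa [show b = z from Fin.ext (by omega)])
    · simp

end WordRAM

namespace WordRAM

open Cmd

variable {n : ℕ} {G : SimpleGraph (Fin n)} {L : AdjLists G} {W D : ℕ} {s : State} {c : Fin n}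

theorem total_gather (hc : G.Connected) {a x y : Fin n} {M : ℕ} (hT : Table L [a, x, y, c] s)
    (h3 : s.reg 3 = c) (hM : (Finset.univ.filter fun v => G.dist c v ≤ 7).card ≤ M)
    (hW : n * (M + 5) + 9 ≤ W) (hD : ∀ v, (L.nbrs v).length ≤ D) (hDW : n * D + 1 ≤ W) :
    Total W gather (n * 9 + n * (M + 4) * (D * 12 + 20) + n * (D * 12 + 12) + 17) s fun s' =>
      ∃ B : List (Fin n), Rows G (n * 4) B s' ∧ (∀ b, b ∈ B ↔ G.dist c b ≤ 7) ∧ B.length ≤ M ∧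
      ∃ q : List (Fin n), q.length = n ∧ (∀ v, v ∈ q) ∧
        q.Pairwise (fun x y => G.dist c x ≤ G.dist c y) ∧
        ∀ i (h : i < q.length), s'.arr 4 i = q[i] := by
  have hlen : ∀ B : List (Fin n), B.Nodup → (∀ b ∈ B, G.dist c b ≤ 7) → B.length ≤ M := by
    intro B hB hb
    rw [← List.toFinset_card_of_nodup hB]
    refine (Finset.card_le_card fun b h => ?_).trans hM
    simpa using hb b (List.mem_toFinset.1 h)
  have h0 := hT.setup.size
  have h2 := hT.next
  simp only [List.length_cons, List.length_nil, Nat.zero_add, Nat.reduceAdd] at h2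
  have hcn := c.isLt
  have hnM := Nat.mul_le_mul_left n (show 5 ≤ M + 5 by omega)
  have hS : Table L [a, x, y, c] (((((s.setReg 16 (n * 4)).setReg 17 (n * 3)).setReg 18 c).setReg
      19 9).setReg 14 0) :=
    ((((hT.setReg (by decide) (by decide) (by decide) (by decide)).setReg
      (by decide) (by decide) (by decide) (by decide)).setReg
      (by decide) (by decide) (by decide) (by decide)).setReg
      (by decide) (by decide) (by decide) (by decide)).setReg
      (by decide) (by decide) (by decide) (by decide)
  have hS' : ((((s.setReg 16 (s.reg 2)).setReg 17 ((s.setReg 16 (s.reg 2)).reg 2 -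
      (s.setReg 16 (s.reg 2)).reg 0)).setReg 18 (((s.setReg 16 (s.reg 2)).setReg 17
      ((s.setReg 16 (s.reg 2)).reg 2 - (s.setReg 16 (s.reg 2)).reg 0)).reg 3)).setReg
      19 9).setReg 14 0 = ((((s.setReg 16 (n * 4)).setReg 17 (n * 3)).setReg 18 c).setReg
      19 9).setReg 14 0 := by
    have : n * 4 - n = n * 3 := by omega
    simp [h2, h0, h3, this]
  unfold gather
  refine Total.of_le (T := 1 + (1 + (1 + (1 + (1 + ((n * (8 + 1) + n * (M + 4) * (D * 12 + 20) + 1) +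
    (1 + (1 + ((n * (D * 12 + 12) + 8) + 1)))))))))
    (Total.copy (by omega) <| Total.sub (by simp [h0, h2]; omega) <|
    Total.copy (by simp [h3]; omega) <| Total.const (by omega) <| Total.const (by omega) ?_)
    (by omega)
  rw [hS']
  refine Total.cons (Total.loop_amortized (C := 8) (B := n * (M + 4) * (D * 12 + 20))
    (fun i s' => s'.reg 14 = i ∧ ∃ B : List (Fin n), Table L ([a, x, y, c] ++ B) s' ∧ B.Nodup ∧
      ∀ b : Fin n, b ∈ B ↔ b.val < i ∧ G.dist c b ≤ 7)
    (fun s' => s'.reg 2 * (D * 12 + 20)) n ?_ ?_ ?_) ?_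
  · exact ⟨by simp, [], hS, by simp, by simp⟩
  · rintro i s' hi ⟨h14, B, hTB, hnd, hB⟩ hf
    have e17 := hf.reg 17 (by decide)
    have e19 := hf.reg 19 (by decide)
    simp at e17 e19
    obtain ⟨T, hstep⟩ := total_gatherStep hc hi hTB h14 e17 e19 hB
      (hlen B hnd fun b hb => ((hB b).1 hb).2) (by omega) hD hDW
    refine ⟨by rw [h14, hTB.setup.size]; exact hi, T, hstep.mono le_rfl ?_⟩
    rintro s'' ⟨⟨h14', e, hTe, hBe, he⟩, hφ⟩ -
    refine ⟨⟨h14', B ++ e, hTe, ?_, hBe⟩, hφ⟩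
    rcases he with rfl | ⟨z, hz, rfl⟩
    · rwa [List.append_nil]
    · rw [List.nodup_append]
      refine ⟨hnd, List.nodup_singleton _, ?_⟩
      intro b hb b' hb' hbb
      rw [List.mem_singleton] at hb'
      have := ((hB b).1 hb).1
      rw [hbb, hb'] at this
      omega
  · rintro s' ⟨h14, B, hTB, hnd, hB⟩ hf
    refine ⟨by rw [h14, hTB.setup.size]; exact lt_irrefl n, Nat.mul_le_mul_right _ ?_⟩
    rw [hTB.next]
    refine Nat.mul_le_mul_left n ?_
    have := hlen B hnd fun b hb => ((hB b).1 hb).2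
    simp only [List.length_append, List.length_cons, List.length_nil]
    omega
  · rintro s' ⟨-, B, hTB, hnd, hB⟩ hf
    have hBM := hlen B hnd fun b hb => ((hB b).1 hb).2
    have e16 := hf.reg 16 (by decide)
    have e18 := hf.reg 18 (by decide)
    simp at e16 e18
    have e2 := hTB.next
    simp only [List.length_append, List.length_cons, List.length_nil, Nat.zero_add,
      Nat.reduceAdd] at e2
    have hnB := Nat.mul_le_mul_left n (show B.length + 5 ≤ M + 5 by omega)
    have hadd : n * (4 + B.length) + n = n * (B.length + 5) := by ring
    refine Total.copy (by omega) <| Total.copy (by simp [e18]; omega) <|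
      Total.cons (total_bfs_table (c := c) hc
        ((hTB.setReg (by decide) (by decide) (by decide) (by decide)).setReg
          (by decide) (by decide) (by decide) (by decide)) (by simp [e18])
        (by
          simp only [List.length_append, List.length_cons, List.length_nil]
          rw [show 0 + 1 + 1 + 1 + 1 + B.length + 1 = B.length + 5 by omega]
          omega) hD hDW) ?_
    rintro s'' ⟨hT'', -, hq⟩ hf'
    have e16' := hf'.reg 16 (by decide)
    have e20' := hf'.reg 20 (by decide)
    simp [e16, e2] at e16' e20'
    refine Total.nil ⟨B, ⟨hT''.setup.size, hT''.setup.one, hT''.setup.zero, e16', ?_, ?_⟩, ?_, hBM, hq⟩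
    · rw [e20']; ring
    · intro k hk v
      have hlt : 4 + k < ([a, x, y, c] ++ B ++ [c]).length := by simp; omega
      have hget : ([a, x, y, c] ++ B ++ [c])[4 + k] = B[k] := by
        rw [List.getElem_append_left (by simp; omega), List.getElem_append_right (by simp)]
        simp
      rw [show n * 4 + n * k + v = n * (4 + k) + v by ring, hT''.dist (4 + k) hlt v, hget]
    · intro b
      rw [hB]
      exact ⟨fun h => h.2, fun h => ⟨b.isLt, h⟩⟩

theorem eccent_eq_of_isMaxDetour (hc : G.Connected) (hG : G.IsChordal) {a x y : Fin n}
    (hm : IsMidpoint G a x y c) {B R : List (Fin n)} (hB : ∀ b, b ∈ B ↔ G.dist c b ≤ 7)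
    (hR : ∀ u, ∃ r ∈ R, Dominates G B r u) {v : Fin n} {e : ℕ} (he : IsMaxDetour G B R v e) :
    (e : ℕ∞) = G.eccent v := by
  apply le_antisymm
  · obtain ⟨r, -, hr⟩ := he.2
    obtain ⟨b, hb, z, hz⟩ := hG.exists_detour_le_eccentricity hc hm.1 hm.2.1 hm.2.2 r v
    have h1 := hr b ((hB b).2 hb)
    have h2 := G.dist_comm (u := r) (v := b)
    calc (e : ℕ∞) ≤ (G.dist v z : ℕ) := by exact_mod_cast (by omega : e ≤ G.dist v z)
      _ = G.edist v z := (hc v z).coe_dist_eq_edist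
      _ ≤ _ := G.edist_le_eccent
  · rw [SimpleGraph.eccent_le_iff]
    intro u
    obtain ⟨r, hr, hd⟩ := hR u
    obtain ⟨b, hb, hbe⟩ := he.1 r hr
    have h1 := hd b hb
    have h2 := hc.dist_triangle (u := v) (v := b) (w := u)
    have h3 := G.dist_comm (u := v) (v := b)
    rw [← (hc v u).coe_dist_eq_edist]
    exact_mod_cast (by omega : G.dist v u ≤ e)

theorem total_eccentricities [DecidableRel G.Adj] (hc : G.Connected) (hG : G.IsChordal)
    (hD : ∀ v, G.degree v ≤ D) (hW : n * ((D + 1) ^ 7 + D + 6) + 9 ≤ W) :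
    Total W eccentricities (n * (5 * (D * 12 + 12) + 24 + ((D + 1) ^ 7 + 4) * (D * 12 + 20) +
        15 ^ (D + 1) ^ 7 * ((D + 1) ^ 7 * 21 + 20) + 22) + 64) L.inputState fun s' =>
      ∀ v : Fin n, ((s'.arr 2 v : ℕ) : ℕ∞) = G.eccent v := by
  obtain ⟨v₀⟩ := hc.nonempty
  have hn : 0 < n := v₀.pos
  have hD' : ∀ v, (L.nbrs v).length ≤ D := fun v => by rw [L.length_nbrs]; exact hD v
  have hball := fun c => hc.card_ball_le hD c 7
  set M := (D + 1) ^ 7 with hMdef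
  have hWM : n * M + n * D + n * 6 + 9 ≤ W := by
    rw [← Nat.mul_add, ← Nat.mul_add]; exact hW
  have e5 : n * (M + 5) = n * M + n * 5 := Nat.mul_add ..
  unfold eccentricities
  refine Total.of_le (T := (4 * (n * (D * 12 + 12) + 8) + n * 15 + 7) +
    ((n * 9 + n * (M + 4) * (D * 12 + 20) + n * (D * 12 + 12) + 17) +
    ((n * (15 ^ M * (M * 10 + 10) + 13) + 4) + ((n * (15 ^ M * (M * 11 + 10) + 9) + 3) + 1))))
    (Total.cons (total_center hc hn (by omega) hD' (by omega)) ?_) (by ring_nf; omega)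
  rintro s₁ ⟨a, x, y, c, hm, hT, h3⟩ -
  refine Total.cons (total_gather hc hT h3 (hball c) (by omega) hD' (by omega)) ?_
  rintro s₂ ⟨B, hrows, hB, hBM, q, hqn, hall, hq, h4⟩ -
  have hBne : B ≠ [] := List.ne_nil_of_mem ((hB c).2 (by simp))
  have hnB := Nat.mul_le_mul_left n hBM
  have hpow : 15 ^ B.length ≤ 15 ^ M := Nat.pow_le_pow_right (by norm_num) hBM
  refine Total.cons ((total_collect hc hqn hq hall (K := 7) (fun b hb => (hB b).1 hb) hrows h4
    (by omega)).of_le ?_) ?_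
  · gcongr
  rintro s₃ ⟨R, hR, hRn, hRlen, hdom⟩ hf
  have hRne : R ≠ [] := by
    obtain ⟨r, hr, -⟩ := hdom c
    exact List.ne_nil_of_mem hr
  have hrows' : Rows G (n * 4) B s₃ := Rows.frame hf hrows
    (by decide) (by decide) (by decide) (by decide) (by decide) (by decide)
  refine Total.cons ((total_output hc hrows' hR hRn hRne (by omega) hBne).of_le ?_) ?_
  · have : R.length ≤ 15 ^ M := hRlen.trans hpow
    gcongr
  rintro s₄ hout -
  exact Total.nil fun v => eccent_eq_of_isMaxDetour hc hG hm hB hdom (hout v)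

end WordRAM

/-- One word-RAM program computes all eccentricities of chordal graphs of bounded degree in linear
time. -/
theorem mainTheorem12 :
    ∃ P : WordRAM.Cmd, ∀ Δ : ℕ, ∃ c : ℕ,
      ∀ (n : ℕ) (G : SimpleGraph (Fin n)) [DecidableRel G.Adj],
        G.Connected → G.IsChordal → (∀ v, G.degree v ≤ Δ) →
        ∀ L : WordRAM.AdjLists G,
          ∃ (t : ℕ) (s : WordRAM.State),
            WordRAM.Exec (c * (n + 1)) P L.inputState t s ∧
            t ≤ c * (G.edgeFinset.card + 1) ∧
            ∀ v : Fin n, ((s.arr 2 v.val : ℕ) : ℕ∞) = G.eccent v := by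
  refine ⟨WordRAM.eccentricities, fun Δ => ?_⟩
  obtain ⟨A, hA⟩ : ∃ A, A = 5 * (Δ * 12 + 12) + 24 + ((Δ + 1) ^ 7 + 4) * (Δ * 12 + 20) +
    15 ^ (Δ + 1) ^ 7 * ((Δ + 1) ^ 7 * 21 + 20) + 22 := ⟨_, rfl⟩
  obtain ⟨M, hM⟩ : ∃ M, M = (Δ + 1) ^ 7 + Δ + 6 := ⟨_, rfl⟩
  refine ⟨A + M + 64, fun n G _ hc hG hD L => ?_⟩
  obtain ⟨t, s, he, ht, hs⟩ := WordRAM.total_eccentricities (W := (A + M + 64) * (n + 1)) (L := L)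
    hc hG hD (by rw [← hM]; nlinarith [Nat.zero_le (A * n)])
  refine ⟨t, s, he, ht.trans ?_, hs⟩
  have hnm : n ≤ G.edgeFinset.card + 1 := by
    have := hc.card_vert_le_card_edgeSet_add_one
    rwa [Nat.card_eq_fintype_card, Fintype.card_fin, Nat.card_eq_fintype_card,
      ← SimpleGraph.edgeFinset_card] at this
  rw [← hA]
  nlinarith [Nat.mul_le_mul_left A hnm, Nat.zero_le (M * (G.edgeFinset.card + 1))]
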